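/- **Theorem 5.1 (Littlewood–Richardson rule for Schur multiple zeta functions).** For a partition $\lambda$ let $D(\lambda)$ be the set of boxes of its Young diagram, and for a filling $\boldsymbol{s}=(s_{ij})_{(i,j)\in D(\lambda)}$ of $D(\lambda)$ by complex numbers put $$\zeta_\lambda(\boldsymbol{s})=\sum_{M}\ \prod_{(i,j)\in D(\lambda)}\frac{1}{m_{ij}^{\,s_{ij}}},$$ where $M=(m_{ij})$ runs over all semistandard Young tableaux of shape $\lambda$ with positive integer entries (rows weakly increasing, columns strictly increasing). For partitions $\mu\subseteq\lambda$ and $\nu$, let $c^{\lambda}_{\mu\nu}$ be the number of skew semistandard tableaux of shape $\lambda/\mu$ and weight $\nu$ (the entry $k$ occurs $\nu_k$ times for each $k\ge 1$) whose reading word $w$ is a Yamanouchi word. Here the reading word is the concatenation of the rows, each read from left to right, starting from the bottom row, and a word is Yamanouchi if for every $i\ge1$ each of its final segments contains at least as many letters $i$ as letters $i+1$. Let $\mu$ and $\nu$ be partitions, and let $\boldsymbol{s}=(s_{ij})$ and $\boldsymbol{t}=(t_{ij})$ be fillings of $D(\mu)$ and $D(\nu)$ by complex numbers, all of real part greater than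 $1$. For each partition $\lambda\supseteq\mu$ with $|\lambda/\mu|=|\nu|$, fix a filling $\boldsymbol{u}_\lambda$ of $D(\lambda)$ in which each of the $|\mu|+|\nu|$ variables $s_{ij}$ ($(i,j)\in D(\mu)$), $t_{ij}$ ($(i,j)\in D(\nu)$), regarded as distinct indeterminates, is used exactly once. Then $$\sum_{sym}\zeta_\mu(\boldsymbol{s})\,\zeta_\nu(\boldsymbol{t})=\sum_{sym}\ \sum_{\lambda}c^{\lambda}_{\mu\nu}\,\zeta_\lambda(\boldsymbol{u}_\lambda),$$ where $\lambda$ runs over the partitions $\lambda\supseteq\mu$ with $|\lambda/\mu|=|\nu|$, and $\sum_{sym}$ is the sum over all $(|\mu|+|\nu|)!$ permutations of these variables as indeterminates. All the series $\zeta_\mu$, $\zeta_\nu$, $\zeta_\lambda$ occurring here converge absolutely. -/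

import Mathlib

/-- Semistandard Young tableaux of shape `lam` with entries in the positive integers (Mathlib's
tableaux may also contain the entry `0`). -/
abbrev PosSSYT (lam : YoungDiagram) : Type :=
  {M : SemistandardYoungTableau lam // ∀ i j : ℕ, (i, j) ∈ lam → 0 < M i j}

/-- The term `1 / M^s`, where `M^s` is the product over all boxes `(i, j)` of `lam` of
`m_{ij} ^ s_{ij}`. A filling of the boxes by complex numbers is a function on `lam.cells`. -/
noncomputable def schurZetaTerm (lam : YoungDiagram) (s : lam.cells → ℂ) (M : PosSSYT lam) : ℂ :=
  1 / ∏ c : lam.cells, (M.1 c.1.1 c.1.2 : ℂ) ^ s c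

/-- The Schur multiple zeta function of shape `lam`. -/
noncomputable def schurZeta (lam : YoungDiagram) (s : lam.cells → ℂ) : ℂ :=
  ∑' M : PosSSYT lam, schurZetaTerm lam s M

/-- Skew semistandard tableaux of shape `lam / mu` (meant for `mu ≤ lam`) with entries in the
positive integers: the rows increase weakly and the columns increase strictly. The entry function
is extended by zero outside the skew diagram. Rows and columns are numbered from zero. -/
@[ext]
structure SkewSSYT (lam mu : YoungDiagram) where
  entry : ℕ → ℕ → ℕ
  row_weak : ∀ i j₁ j₂ : ℕ, j₁ < j₂ → (i, j₁) ∉ mu → (i, j₂) ∈ lam → entry i j₁ ≤ entry i j₂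
  col_strict : ∀ i₁ i₂ j : ℕ, i₁ < i₂ → (i₁, j) ∉ mu → (i₂, j) ∈ lam → entry i₁ j < entry i₂ j
  pos : ∀ i j : ℕ, (i, j) ∈ lam → (i, j) ∉ mu → 0 < entry i j
  zeros : ∀ i j : ℕ, (i, j) ∉ lam ∨ (i, j) ∈ mu → entry i j = 0

/-- The reading word: the rows are read from left to right and concatenated, starting from the
bottom row. -/
def SkewSSYT.readingWord {lam mu : YoungDiagram} (T : SkewSSYT lam mu) : List ℕ :=
  (List.range (lam.colLen 0)).reverse.flatMap fun i =>
    (List.range' (mu.rowLen i) (lam.rowLen i - mu.rowLen i)).map fun j => T.entry i j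

/-- The tableau has weight `nu`: for every `k`, the entry `k + 1` occurs in as many boxes as the
row of `nu` with (zero-based) number `k` has. -/
def SkewSSYT.HasWeight {lam mu : YoungDiagram} (T : SkewSSYT lam mu) (nu : YoungDiagram) : Prop :=
  ∀ k : ℕ, ((lam.cells \ mu.cells).filter fun c => T.entry c.1 c.2 = k + 1).card = nu.rowLen k

/-- A word in the positive integers is a Yamanouchi word if each of its final segments contains,
for every `i ≥ 1`, at least as many letters `i` as letters `i + 1`. -/
def IsYamanouchi (w : List ℕ) : Prop :=
  ∀ i j : ℕ, 1 ≤ i → (w.drop j).count (i + 1) ≤ (w.drop j).count i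

/-- The skew semistandard tableaux of shape `lam / mu` and weight `nu` whose reading word is a
Yamanouchi word. -/
abbrev LRTableau (mu nu lam : YoungDiagram) : Type :=
  {T : SkewSSYT lam mu // T.HasWeight nu ∧ IsYamanouchi T.readingWord}

theorem SkewSSYT.entry_le {lam mu nu : YoungDiagram} (T : SkewSSYT lam mu) (h : T.HasWeight nu)
    (i j : ℕ) : T.entry i j ≤ nu.colLen 0 := by
  by_cases hc : (i, j) ∈ lam ∧ (i, j) ∉ mu
  · have hp := T.pos i j hc.1 hc.2
    have h1 := h (T.entry i j - 1)
    have h2 : 0 < nu.rowLen (T.entry i j - 1) := by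
      rw [← h1, Finset.card_pos]
      refine ⟨(i, j), ?_⟩
      simp only [Finset.mem_filter, Finset.mem_sdiff, YoungDiagram.mem_cells]
      exact ⟨hc, by omega⟩
    have h3 := YoungDiagram.mem_iff_lt_colLen.1 (YoungDiagram.mem_iff_lt_rowLen.2 h2)
    omega
  · rw [T.zeros i j (by tauto)]
    exact Nat.zero_le _

/-- The tableaux counted by a Littlewood-Richardson coefficient are finite in number. -/
instance LRTableau.finite (mu nu lam : YoungDiagram) : Finite (LRTableau mu nu lam) := by
  let f : LRTableau mu nu lam → (lam.cells → Fin (nu.colLen 0 + 1)) := fun T c =>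
    ⟨T.1.entry c.1.1 c.1.2, Nat.lt_succ_of_le (T.1.entry_le T.2.1 _ _)⟩
  refine Finite.of_injective f fun T T' hf => Subtype.ext (SkewSSYT.ext ?_)
  funext i j
  by_cases hc : (i, j) ∈ lam
  · exact congrArg Fin.val (congrFun hf ⟨(i, j), (YoungDiagram.mem_cells _).2 hc⟩)
  · rw [T.1.zeros i j (Or.inl hc), T'.1.zeros i j (Or.inl hc)]

/-- The Littlewood-Richardson coefficient (with lower indices `mu`, `nu` and upper index `lam`,
where `mu ≤ lam`). -/
noncomputable def littlewoodRichardson (mu nu lam : YoungDiagram) : ℕ :=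
  Nat.card (LRTableau mu nu lam)

/-- The partitions `lam` containing `mu` such that `lam / mu` has the same size as `nu`. -/
abbrev SkewExtension (mu nu : YoungDiagram) : Type :=
  {lam : YoungDiagram // mu ≤ lam ∧ (lam.cells \ mu.cells).card = nu.card}

instance SkewExtension.finite (mu nu : YoungDiagram) : Finite (SkewExtension mu nu) := by
  let n := mu.card + nu.card
  have key : ∀ lam : SkewExtension mu nu,
      lam.1.cells ∈ (Finset.range n ×ˢ Finset.range n).powerset := by
    rintro ⟨lam, h1, h2⟩
    have hn : lam.cells.card = n := by
      have h := Finset.card_sdiff_add_card_eq_card (YoungDiagram.cells_subset_iff.2 h1)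
      have hmu : mu.cells.card = mu.card := rfl
      omega
    rw [Finset.mem_powerset]
    rintro ⟨i, j⟩ hc
    have hc' : (i, j) ∈ lam := (YoungDiagram.mem_cells _).1 hc
    have hi := YoungDiagram.mem_iff_lt_colLen.1 hc'
    have hj := YoungDiagram.mem_iff_lt_rowLen.1 hc'
    have hi' : lam.colLen j ≤ n := by
      rw [YoungDiagram.colLen_eq_card, ← hn]
      exact Finset.card_le_card (Finset.filter_subset _ _)
    have hj' : lam.rowLen i ≤ n := by
      rw [YoungDiagram.rowLen_eq_card, ← hn]
      exact Finset.card_le_card (Finset.filter_subset _ _)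
    simp only [Finset.mem_product, Finset.mem_range]
    omega
  refine Finite.of_injective
    (fun lam => (⟨lam.1.cells, key lam⟩ : (Finset.range n ×ˢ Finset.range n).powerset)) ?_
  intro a b hab
  exact Subtype.ext (YoungDiagram.ext (congrArg Subtype.val hab))

noncomputable instance SkewExtension.fintype (mu nu : YoungDiagram) :
    Fintype (SkewExtension mu nu) := Fintype.ofFinite _

/-!
Multiplying out and summing over all permutations of the variables, the contribution of a pair of
tableaux depends only on its total content, that is, on how often each positive integer occurs in
it (`sum_perm_term_eq`); the same holds for the right-hand side. The theorem thus follows from the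
classical Littlewood-Richardson rule in the form of a bijection that preserves contents
(`exists_content_preserving_equiv`). Convergence comes from comparison with a product of series
`∑ 1 / m ^ x` with `x > 1`.

The Littlewood-Richardson rule is proved by Stembridge's argument. Tableaux with entries at most `n`
are encoded as chains of partitions growing by horizontal strips (`StripChain`), in which a
Bender-Knuth involution reflects the row lengths of one partition in the intervals that its two
neighbours leave for them (`StripChain.toggle`). Applied to all columns, it shows that Schur
polynomials are symmetric, so that the product of the alternant with exponents `a` and a Schur
polynomial is the sum of the alternants with exponents `a + weight g` (`alternant_mul_schurPoly`).
For `a = mu + staircase`, the terms that are not dominant relative to `mu` cancel under the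
involution applied to the columns left of the first failure
(`StripChain.sum_alternant_eq_sum_dominant`). For `mu = 0` a single term is left, which is the
bialternant formula. Together these give the product of two Schur polynomials as a sum over
dominant tableaux of shape `nu` (`schurPoly_mul_schurPoly`).

Dominance read by columns agrees with dominance read by rows (`StripChain.dominant_iff_rows`), and
in the latter form it is the column-strictness of a companion filling of `lam / mu`, whose lattice
property in turn is the semistandardness of the tableau of shape `nu`
(`StripChain.companionEquiv`). The companions are the Littlewood-Richardson tableaux (`lrEquiv`).
-/

/-! ### Chains of horizontal strips -/

/-- A chain `mu = part 0 ⊆ part 1 ⊆ ⋯ ⊆ part n = lam` of partitions, given by their row lengths, in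
which each partition arises from the one before by adding a horizontal strip; from index `n` on the
chain is constant. Such a chain encodes a semistandard tableau of shape `lam / mu` with entries in
`{1, …, n}`: the partition `part k` consists of `mu` and the boxes with entry at most `k`. For
`mu = 0` these are the Gelfand-Tsetlin patterns with top row `lam`. -/
@[ext]
structure StripChain (n : ℕ) (mu lam : ℕ → ℕ) where
  part : ℕ → ℕ → ℕ
  bot : ∀ i, part 0 i = mu i
  top : ∀ k i, n ≤ k → part k i = lam i
  mono : ∀ k i, part k i ≤ part (k + 1) i
  strip : ∀ k i, part (k + 1) (i + 1) ≤ part k i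

namespace StripChain

variable {n : ℕ} {mu nu lam : ℕ → ℕ}

theorem part_le_part (g : StripChain n mu lam) (i : ℕ) : Monotone fun k => g.part k i :=
  monotone_nat_of_le_succ fun k => g.mono k i

theorem part_le_top (g : StripChain n mu lam) (k i : ℕ) : g.part k i ≤ lam i := by
  rw [← g.top (max n k) i (le_max_left _ _)]
  exact g.part_le_part i (le_max_right _ _)

theorem bot_le_part (g : StripChain n mu lam) (k i : ℕ) : mu i ≤ g.part k i := by
  rw [← g.bot i]
  exact g.part_le_part i (Nat.zero_le _)

theorem part_antitone (g : StripChain n mu lam) (k : ℕ) : Antitone (g.part k) :=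
  antitone_nat_of_succ_le fun i => (g.mono k (i + 1)).trans (g.strip k i)

theorem part_eq_zero (g : StripChain n 0 lam) {k i : ℕ} (h : k ≤ i) : g.part k i = 0 := by
  induction k generalizing i with
  | zero => exact g.bot i
  | succ k ih =>
    obtain ⟨i, rfl⟩ : ∃ i', i = i' + 1 := ⟨i - 1, by omega⟩
    have := g.strip k i
    rw [ih (by omega)] at this
    omega

theorem top_eq_zero (g : StripChain n 0 lam) {i : ℕ} (h : n ≤ i) : lam i = 0 := by
  rw [← g.top n i le_rfl, g.part_eq_zero h]

instance finite (n : ℕ) (lam : ℕ → ℕ) : Finite (StripChain n 0 lam) := by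
  let f : StripChain n 0 lam → ((k i : Fin n) → Fin (lam i + 1)) := fun g k i =>
    ⟨g.part k i, Nat.lt_succ_of_le (g.part_le_top k i)⟩
  refine Finite.of_injective f fun g g' h => ?_
  ext k i
  by_cases hk : k < n
  · by_cases hi : i < n
    · exact congrArg Fin.val (congrFun (congrFun h ⟨k, hk⟩) ⟨i, hi⟩)
    · rw [g.part_eq_zero (by omega), g'.part_eq_zero (by omega)]
  · rw [g.top k i (by omega), g'.top k i (by omega)]

noncomputable instance fintype (n : ℕ) (lam : ℕ → ℕ) : Fintype (StripChain n 0 lam) :=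
  Fintype.ofFinite _

/-- The number of boxes added in passing from `part k` to `part (k + 1)`, that is, the number of
entries `k + 1` of the tableau encoded by `g`. Only the rows with numbers below `n` are counted. -/
def weight (g : StripChain n mu lam) (k : ℕ) : ℕ :=
  ∑ i ∈ Finset.range n, (g.part (k + 1) i - g.part k i)

/-- The number of boxes of the partition `g.part k` in the columns from number `j` on. -/
def tail (g : StripChain n mu lam) (k j : ℕ) : ℕ :=
  ∑ i ∈ Finset.range n, (g.part k i - j)

theorem tail_add_weight (g : StripChain n mu lam) (k : ℕ) :
    g.tail k 0 + g.weight k = g.tail (k + 1) 0 := by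
  simp only [tail, weight, ← Finset.sum_add_distrib]
  refine Finset.sum_congr rfl fun i _ => ?_
  have := g.mono k i
  omega

theorem tail_mono (g : StripChain n mu lam) (k j : ℕ) : g.tail k j ≤ g.tail (k + 1) j :=
  Finset.sum_le_sum fun i _ => Nat.sub_le_sub_right (g.mono k i) j

/-! ### The Bender-Knuth involution -/

/-- The largest length that row `i` of a partition between `a` and `c` can have if both steps are
horizontal strips; the smallest length is `max (a i) (c (i + 1))`. -/
def ceil (a c : ℕ → ℕ) : ℕ → ℕ
  | 0 => c 0
  | i + 1 => min (a i) (c (i + 1))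

/-- The lower and the upper bounds for the rows add up to the rows of `a` and `c`, since
`min (a i) (c (i + 1)) + max (a i) (c (i + 1)) = a i + c (i + 1)`. Hence reflecting every row in its
interval of admissible lengths exchanges the two step sizes. -/
theorem sum_max_add_sum_ceil (a c : ℕ → ℕ) (N : ℕ) :
    ∑ i ∈ Finset.range N, max (a i) (c (i + 1)) + ∑ i ∈ Finset.range (N + 1), ceil a c i =
      ∑ i ∈ Finset.range N, a i + ∑ i ∈ Finset.range (N + 1), c i := by
  induction N with
  | zero => simp [ceil]
  | succ N ih =>
    rw [Finset.sum_range_succ, Finset.sum_range_succ _ (N + 1), Finset.sum_range_succ a,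
      Finset.sum_range_succ c (N + 1)]
    have h : ceil a c (N + 1) = min (a N) (c (N + 1)) := rfl
    omega

/-- The rows of the partition that replaces `b` when the Bender-Knuth involution is applied to the
columns with numbers below `j`: with all partitions cut off at column `j`, each row is reflected in
its interval of admissible lengths, and the boxes from column `j` on are put back. -/
def toggleRow (a b c : ℕ → ℕ) (j i : ℕ) : ℕ :=
  max (min (a i) j) (min (c (i + 1)) j) +
    ceil (fun i => min (a i) j) (fun i => min (c i) j) i - min (b i) j + (b i - j)

section ToggleRow

variable {a b c : ℕ → ℕ} {j : ℕ}

/-- The partitions `a ⊆ b ⊆ c` differ by horizontal strips, and column `j` contains no box of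
`b / a`. The latter makes it possible to change the columns before `j` alone. -/
structure Interlace (a b c : ℕ → ℕ) (j : ℕ) : Prop where
  mono₁ : ∀ i, a i ≤ b i
  mono₂ : ∀ i, b i ≤ c i
  strip₁ : ∀ i, b (i + 1) ≤ a i
  strip₂ : ∀ i, c (i + 1) ≤ b i
  cut : ∀ i, j < b i → j < a i

theorem Interlace.toggleRow_bounds (h : Interlace a b c j) (i : ℕ) :
    a i ≤ toggleRow a b c j i ∧ toggleRow a b c j i ≤ c i ∧
      toggleRow a b c j (i + 1) ≤ a i ∧ c (i + 1) ≤ toggleRow a b c j i ∧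
      toggleRow a b c j i - j = b i - j ∧
      min (toggleRow a b c j i) j + min (b i) j = max (min (a i) j) (min (c (i + 1)) j) +
        ceil (fun i => min (a i) j) (fun i => min (c i) j) i := by
  have h1 := h.mono₁ i
  have h2 := h.mono₂ i
  have h3 := h.strip₁ i
  have h4 := h.strip₂ i
  have h5 := h.cut i
  have h6 := h.mono₁ (i + 1)
  have h7 := h.mono₂ (i + 1)
  have h8 := h.strip₂ (i + 1)
  have h9 := h.cut (i + 1)
  cases i with
  | zero =>
    simp only [toggleRow, ceil]
    omega
  | succ i =>
    have k1 := h.mono₁ i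
    have k2 := h.mono₂ i
    have k3 := h.strip₁ i
    have k4 := h.strip₂ i
    have k5 := h.cut i
    simp only [toggleRow, ceil]
    omega

theorem Interlace.toggle (h : Interlace a b c j) :
    Interlace a (toggleRow a b c j) c j where
  mono₁ i := (h.toggleRow_bounds i).1
  mono₂ i := (h.toggleRow_bounds i).2.1
  strip₁ i := (h.toggleRow_bounds i).2.2.1
  strip₂ i := (h.toggleRow_bounds i).2.2.2.1
  cut i hi := by
    have h1 := (h.toggleRow_bounds i).2.2.2.2.1
    exact h.cut i (by omega)

theorem Interlace.toggleRow_toggleRow (h : Interlace a b c j) :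
    toggleRow a (toggleRow a b c j) c j = b := by
  funext i
  have h1 := (h.toggleRow_bounds i).2.2.2.2
  have h2 := (h.toggle.toggleRow_bounds i).2.2.2.2
  omega

end ToggleRow

theorem interlace (g : StripChain n mu lam) {k j : ℕ}
    (h : ∀ i, j < g.part (k + 1) i → j < g.part k i) :
    Interlace (g.part k) (g.part (k + 1)) (g.part (k + 2)) j :=
  ⟨g.mono k, g.mono (k + 1), g.strip k, g.strip (k + 1), h⟩

/-- The Bender-Knuth involution on the entries `k + 1` and `k + 2` in the columns with numbers below
`j`, where `j` is a column without entry `k + 1`. In terms of the chain, only the partition with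
number `k + 1` changes. -/
def toggle (g : StripChain n mu lam) (k j : ℕ) (hk : k + 1 < n)
    (h : ∀ i, j < g.part (k + 1) i → j < g.part k i) : StripChain n mu lam where
  part := Function.update g.part (k + 1)
    (toggleRow (g.part k) (g.part (k + 1)) (g.part (k + 2)) j)
  bot i := by
    rw [Function.update_of_ne (by omega)]
    exact g.bot i
  top l i hl := by
    rw [Function.update_of_ne (by omega)]
    exact g.top l i hl
  mono l i := by
    have hb := (g.interlace h).toggle
    rcases eq_or_ne l (k + 1) with rfl | h1
    · rw [Function.update_self, Function.update_of_ne (by omega)]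
      exact hb.mono₂ i
    · rcases eq_or_ne l k with rfl | h2
      · rw [Function.update_self, Function.update_of_ne (by omega)]
        exact hb.mono₁ i
      · rw [Function.update_of_ne h1, Function.update_of_ne (by omega)]
        exact g.mono l i
  strip l i := by
    have hb := (g.interlace h).toggle
    rcases eq_or_ne l (k + 1) with rfl | h1
    · rw [Function.update_self, Function.update_of_ne (by omega)]
      exact hb.strip₂ i
    · rcases eq_or_ne l k with rfl | h2
      · rw [Function.update_self, Function.update_of_ne (by omega)]
        exact hb.strip₁ i
      · rw [Function.update_of_ne h1, Function.update_of_ne (by omega)]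
        exact g.strip l i

section Toggle

variable (g : StripChain n mu lam) {k j : ℕ} (hk : k + 1 < n)
  (h : ∀ i, j < g.part (k + 1) i → j < g.part k i)

theorem toggle_part_self : (g.toggle k j hk h).part (k + 1) =
    toggleRow (g.part k) (g.part (k + 1)) (g.part (k + 2)) j :=
  Function.update_self ..

theorem toggle_part_of_ne {l : ℕ} (hl : l ≠ k + 1) : (g.toggle k j hk h).part l = g.part l :=
  Function.update_of_ne hl ..

theorem toggle_cut (i : ℕ) (hi : j < (g.toggle k j hk h).part (k + 1) i) :
    j < (g.toggle k j hk h).part k i := by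
  rw [toggle_part_self] at hi
  rw [toggle_part_of_ne _ _ _ (by omega)]
  exact (g.interlace h).toggle.cut i hi

theorem toggle_toggle :
    (g.toggle k j hk h).toggle k j hk (g.toggle_cut hk h) = g := by
  ext l i
  rcases eq_or_ne l (k + 1) with rfl | hl
  · rw [toggle_part_self, toggle_part_of_ne _ _ _ (by omega), toggle_part_self,
      toggle_part_of_ne _ _ _ (by omega), (g.interlace h).toggleRow_toggleRow]
  · rw [toggle_part_of_ne _ _ _ hl, toggle_part_of_ne _ _ _ hl]

theorem toggle_tail_of_ne {l : ℕ} (hl : l ≠ k + 1) (j' : ℕ) :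
    (g.toggle k j hk h).tail l j' = g.tail l j' := by
  rw [tail, tail, toggle_part_of_ne _ _ _ hl]

theorem toggle_tail {j' : ℕ} (hj : j ≤ j') (l : ℕ) :
    (g.toggle k j hk h).tail l j' = g.tail l j' := by
  rcases eq_or_ne l (k + 1) with rfl | hl
  · rw [tail, tail, toggle_part_self]
    refine Finset.sum_congr rfl fun i _ => ?_
    have := ((g.interlace h).toggleRow_bounds i).2.2.2.2.1
    omega
  · exact g.toggle_tail_of_ne hk h hl j'

end Toggle

theorem tail_zero_eq (g : StripChain n mu lam) (k j : ℕ) :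
    g.tail k 0 = ∑ i ∈ Finset.range n, min (g.part k i) j + g.tail k j := by
  rw [tail, tail, ← Finset.sum_add_distrib]
  exact Finset.sum_congr rfl fun i _ => by omega

/-- The involution exchanges the numbers of entries `k + 1` and `k + 2` in the columns before `j`:
the sizes of the old and the new middle partition, cut off at column `j`, add up to those of their
neighbours. -/
theorem toggle_tail_zero (g : StripChain n 0 lam) {k j : ℕ} (hk : k + 1 < n)
    (h : ∀ i, j < g.part (k + 1) i → j < g.part k i) :
    (g.toggle k j hk h).tail (k + 1) 0 + g.tail (k + 1) 0 + g.tail k j + g.tail (k + 2) j =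
      g.tail k 0 + g.tail (k + 2) 0 + 2 * g.tail (k + 1) j := by
  have e1 := (g.toggle k j hk h).tail_zero_eq (k + 1) j
  have e2 := g.tail_zero_eq k j
  have e3 := g.tail_zero_eq (k + 1) j
  have e4 := g.tail_zero_eq (k + 2) j
  rw [g.toggle_tail hk h le_rfl] at e1
  have e5 : ∑ i ∈ Finset.range n, min ((g.toggle k j hk h).part (k + 1) i) j +
      ∑ i ∈ Finset.range n, min (g.part (k + 1) i) j =
      ∑ i ∈ Finset.range n, min (g.part k i) j +
        ∑ i ∈ Finset.range n, min (g.part (k + 2) i) j := by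
    have key := sum_max_add_sum_ceil (fun i => min (g.part k i) j)
      (fun i => min (g.part (k + 2) i) j) n
    rw [Finset.sum_range_succ, Finset.sum_range_succ _ n] at key
    have z1 : g.part (k + 2) n = 0 := g.part_eq_zero (by omega)
    have z2 : ceil (fun i => min (g.part k i) j) (fun i => min (g.part (k + 2) i) j) n = 0 := by
      obtain ⟨m, rfl⟩ : ∃ m, n = m + 1 := ⟨n - 1, by omega⟩
      simp [ceil, z1]
    rw [z1, z2] at key
    rw [← Finset.sum_add_distrib, toggle_part_self,
      Finset.sum_congr rfl fun i _ => ((g.interlace h).toggleRow_bounds i).2.2.2.2.2,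
      Finset.sum_add_distrib]
    simpa using key
  omega

/-! ### Dominance by columns and by rows -/

/-- The weight of the boxes in the columns from `j` on, added to `m`, has weakly decreasing
components for every `j`. Since `tail (k + 1) j - tail k j` counts the entries `k + 1` in these
columns, the condition is written without subtraction. -/
def Dominant (m : ℕ → ℕ) (g : StripChain n mu lam) : Prop :=
  ∀ k, k + 1 < n → ∀ j,
    m (k + 1) + g.tail (k + 2) j + g.tail k j ≤ m k + 2 * g.tail (k + 1) j

/-- The number of boxes of `g.part k` in column `j`. -/
def height (g : StripChain n mu lam) (k j : ℕ) : ℕ :=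
  ∑ i ∈ Finset.range n, if j < g.part k i then 1 else 0

theorem tail_eq_height_add (g : StripChain n mu lam) (k j : ℕ) :
    g.tail k j = g.height k j + g.tail k (j + 1) := by
  simp only [tail, height, ← Finset.sum_add_distrib]
  refine Finset.sum_congr rfl fun i _ => ?_
  split_ifs <;> omega

theorem height_mono (g : StripChain n mu lam) (k j : ℕ) : g.height k j ≤ g.height (k + 1) j := by
  refine Finset.sum_le_sum fun i _ => ?_
  have := g.mono k i
  split_ifs <;> omega

theorem height_succ_le (g : StripChain n mu lam) (k j : ℕ) :
    g.height (k + 1) j ≤ g.height k j + 1 := by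
  cases n with
  | zero => simp [height]
  | succ n =>
    rw [height, Finset.sum_range_succ', height, Finset.sum_range_succ]
    have : ∑ i ∈ Finset.range n, (if j < g.part (k + 1) (i + 1) then 1 else 0) ≤
        ∑ i ∈ Finset.range n, if j < g.part k i then 1 else 0 := by
      refine Finset.sum_le_sum fun i _ => ?_
      have := g.strip k i
      split_ifs <;> omega
    split_ifs <;> omega

theorem lt_part_of_height_eq (g : StripChain n 0 lam) {k j : ℕ} (hk : k < n)
    (h : g.height (k + 1) j ≤ g.height k j) (i : ℕ) (hi : j < g.part (k + 1) i) :
    j < g.part k i := by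
  have hle : ∀ i ∈ Finset.range n, (if j < g.part k i then 1 else 0) ≤
      if j < g.part (k + 1) i then 1 else 0 := fun i _ => by
    have := g.mono k i
    split_ifs <;> omega
  have hin : i < n := by
    by_contra hc
    rw [g.part_eq_zero (by omega)] at hi
    omega
  have := (Finset.sum_eq_sum_iff_of_le hle).1 (le_antisymm (Finset.sum_le_sum hle) h) i
    (Finset.mem_range.2 hin)
  rw [if_pos hi] at this
  by_contra hc
  rw [if_neg hc] at this
  omega

/-- If dominance fails for the columns from `j` on but holds for those from `j + 1` on, it fails by
exactly one, and column `j` contains no entry `k + 1`: a column holds every entry at most once. -/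
theorem eq_of_violation (g : StripChain n 0 lam) {m : ℕ → ℕ} {k j : ℕ} (hk : k + 1 < n)
    (h : m k + 2 * g.tail (k + 1) j < m (k + 1) + g.tail (k + 2) j + g.tail k j)
    (h' : m (k + 1) + g.tail (k + 2) (j + 1) + g.tail k (j + 1) ≤
      m k + 2 * g.tail (k + 1) (j + 1)) :
    m (k + 1) + g.tail (k + 2) j + g.tail k j = m k + 2 * g.tail (k + 1) j + 1 ∧
      ∀ i, j < g.part (k + 1) i → j < g.part k i := by
  have e0 := g.tail_eq_height_add k j
  have e1 := g.tail_eq_height_add (k + 1) j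
  have e2 := g.tail_eq_height_add (k + 2) j
  have h0 := g.height_mono k j
  have h1 := g.height_succ_le k j
  have h2 : g.height (k + 1) j ≤ g.height (k + 2) j := g.height_mono (k + 1) j
  have h3 : g.height (k + 2) j ≤ g.height (k + 1) j + 1 := g.height_succ_le (k + 1) j
  exact ⟨by omega, g.lt_part_of_height_eq (by omega) (by omega)⟩

section RowReading

theorem sum_range_ite_lt (f : ℕ → ℕ) {q : ℕ} (h : q ≤ n) :
    ∑ i ∈ Finset.range n, (if i < q then f i else 0) = ∑ i ∈ Finset.range q, f i := by
  rw [← Finset.sum_filter]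
  congr 1
  ext i
  simp only [Finset.mem_filter, Finset.mem_range]
  omega

/-- Dominance for the columns from `part (k + 1) q` on, the first one of row `q` behind the entries
up to `k + 1`, amounts to the row condition for row `q`. -/
theorem tail_part_eq (g : StripChain n mu lam) (k : ℕ) {q : ℕ} (hq : q < n) :
    g.tail (k + 2) (g.part (k + 1) q) + g.tail k (g.part (k + 1) q) +
        ∑ i ∈ Finset.range q, (g.part (k + 1) i - g.part k i) =
      2 * g.tail (k + 1) (g.part (k + 1) q) +
        ∑ i ∈ Finset.range (q + 1), (g.part (k + 2) i - g.part (k + 1) i) := by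
  rw [← sum_range_ite_lt _ hq.le, ← sum_range_ite_lt (n := n) _ hq]
  simp only [tail, Finset.mul_sum, ← Finset.sum_add_distrib]
  refine Finset.sum_congr rfl fun i _ => ?_
  have h1 := g.mono k i
  have h2 : g.part (k + 1) i ≤ g.part (k + 2) i := g.mono (k + 1) i
  rcases lt_trichotomy i q with h | rfl | h
  · have h3 := g.strip k i
    rw [if_pos h, if_pos (by omega)]
    have h6 : g.part (k + 1) q ≤ g.part (k + 1) (i + 1) := g.part_antitone (k + 1) h
    omega
  · rw [if_neg (by omega), if_pos (by omega)]
    omega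
  · obtain ⟨i, rfl⟩ : ∃ i', i = i' + 1 := ⟨i - 1, by omega⟩
    have h3 : g.part (k + 2) (i + 1) ≤ g.part (k + 1) i := g.strip (k + 1) i
    have h4 : g.part (k + 1) i ≤ g.part (k + 1) q := g.part_antitone (k + 1) (by omega)
    rw [if_neg (by omega), if_neg (by omega)]
    omega

/-- For every column `j` that meets the boxes with entries up to `k + 2`, the row condition for a
suitable row `q` implies dominance for the columns from `j` on. The row is the last one reaching
beyond column `j`. -/
theorem exists_row_le (g : StripChain n 0 lam) {k : ℕ} (hk : k + 1 < n) {j : ℕ}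
    (hj : j < g.part (k + 2) 0) :
    ∃ q < n, g.tail (k + 2) j + g.tail k j +
        ∑ i ∈ Finset.range q, (g.part (k + 1) i - g.part k i) ≤
      2 * g.tail (k + 1) j +
        ∑ i ∈ Finset.range (q + 1), (g.part (k + 2) i - g.part (k + 1) i) := by
  classical
  have hz : g.part (k + 2) n = 0 := g.part_eq_zero (by omega)
  obtain ⟨q, hq1, hq2⟩ : ∃ q, j < g.part (k + 2) q ∧ g.part (k + 2) (q + 1) ≤ j := by
    by_contra! hc
    have : ∀ q, j < g.part (k + 2) q := fun q => by
      induction q with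
      | zero => exact hj
      | succ q ih => exact hc q ih
    have := this n
    omega
  have hqn : q < n := by
    by_contra hc
    have : g.part (k + 2) q ≤ g.part (k + 2) n := g.part_antitone _ (by omega)
    omega
  refine ⟨q, hqn, ?_⟩
  rw [← sum_range_ite_lt _ hqn.le, ← sum_range_ite_lt (n := n) _ hqn]
  have hbig : ∀ i, q < i → g.part (k + 2) i ≤ j := fun i hi =>
    (g.part_antitone (k + 2) (show q + 1 ≤ i from hi)).trans hq2
  cases q with
  | zero =>
    simp only [tail, Finset.mul_sum, ← Finset.sum_add_distrib]
    refine Finset.sum_le_sum fun i _ => ?_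
    have h1 := g.mono k i
    have h2 : g.part (k + 1) i ≤ g.part (k + 2) i := g.mono (k + 1) i
    rcases Nat.eq_zero_or_pos i with rfl | hi
    · simp
      omega
    · have := hbig i hi
      rw [if_neg (by omega), if_neg (by omega)]
      omega
  | succ p =>
    -- Row by row the inequality can fail only in row `p`, by `j - g.part k p`; as
    -- `g.part (k + 1) (p + 1) ≤ g.part k p`, row `p + 1` makes up for it.
    have e1 : ∑ i ∈ Finset.range n, (if i = p then j - g.part k p else 0) = j - g.part k p := by
      rw [Finset.sum_ite_eq' (Finset.range n) p, if_pos (Finset.mem_range.2 (by omega))]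
    have e2 : ∑ i ∈ Finset.range n, (if i = p + 1 then j - g.part k p else 0) =
        j - g.part k p := by
      rw [Finset.sum_ite_eq' (Finset.range n) (p + 1), if_pos (Finset.mem_range.2 (by omega))]
    suffices h : g.tail (k + 2) j + g.tail k j +
        ∑ i ∈ Finset.range n, (if i < p + 1 then g.part (k + 1) i - g.part k i else 0) +
        ∑ i ∈ Finset.range n, (if i = p + 1 then j - g.part k p else 0) ≤
      2 * g.tail (k + 1) j + ∑ i ∈ Finset.range n,
        (if i < p + 2 then g.part (k + 2) i - g.part (k + 1) i else 0) +
        ∑ i ∈ Finset.range n, (if i = p then j - g.part k p else 0) by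
      rw [e1, e2] at h
      exact Nat.le_of_add_le_add_right h
    simp only [tail, Finset.mul_sum, ← Finset.sum_add_distrib]
    refine Finset.sum_le_sum fun i _ => ?_
    have h1 := g.mono k i
    have h2 : g.part (k + 1) i ≤ g.part (k + 2) i := g.mono (k + 1) i
    have hup : ∀ i, i ≤ p + 1 → j < g.part (k + 2) i := fun i hi =>
      hq1.trans_le (g.part_antitone (k + 2) hi)
    have h3 : g.part (k + 2) (i + 1) ≤ g.part (k + 1) i := g.strip (k + 1) i
    have h4 := g.strip k i
    have h5 : g.part (k + 2) (i + 2) ≤ g.part (k + 1) (i + 1) := g.strip (k + 1) (i + 1)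
    rcases lt_trichotomy i p with hi | rfl | hi
    · have := hup (i + 2) (by omega)
      have := hup i (by omega)
      rw [if_pos (by omega), if_neg (by omega), if_pos (by omega), if_neg (by omega)]
      omega
    · have := hup (i + 1) le_rfl
      rw [if_pos (by omega), if_neg (by omega), if_pos (by omega), if_pos rfl]
      omega
    · rcases eq_or_ne i (p + 1) with rfl | hi'
      · have := hup (p + 1) le_rfl
        have := g.strip k p
        rw [if_neg (by omega), if_pos rfl, if_pos (by omega), if_neg (by omega)]
        omega
      · have := hbig i (by omega)
        rw [if_neg (by omega), if_neg (by omega), if_neg (by omega), if_neg (by omega)]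
        omega

/-- Dominance can be tested by reading rows instead of columns: it suffices to compare, for every
`q`, the entries `k + 2` in the rows up to `q` with the entries `k + 1` in the rows before `q`. -/
theorem dominant_iff_rows {m : ℕ → ℕ} (hm : Antitone m) (g : StripChain n 0 lam) :
    g.Dominant m ↔ ∀ k, k + 1 < n → ∀ q < n,
      m (k + 1) + ∑ i ∈ Finset.range (q + 1), (g.part (k + 2) i - g.part (k + 1) i) ≤
        m k + ∑ i ∈ Finset.range q, (g.part (k + 1) i - g.part k i) := by
  refine ⟨fun h k hk q hq => ?_, fun h k hk j => ?_⟩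
  · have h1 := h k hk (g.part (k + 1) q)
    have h2 := g.tail_part_eq k hq
    omega
  · by_cases hj : j < g.part (k + 2) 0
    · obtain ⟨q, hq, h1⟩ := g.exists_row_le hk hj
      have h2 := h k hk q hq
      omega
    · have h0 : g.tail (k + 2) j = 0 := Finset.sum_eq_zero fun i _ => by
        have := g.part_antitone (k + 2) (Nat.zero_le i)
        omega
      have h1 := g.tail_mono (k + 1) j
      have h2 := g.tail_mono k j
      have h3 := hm (Nat.le_succ k)
      have h4 : g.tail (k + 1 + 1) j = g.tail (k + 2) j := rfl
      simp only [Nat.succ_eq_add_one] at h3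
      omega

end RowReading

end StripChain

/-! ### Alternants and Schur polynomials -/

section Polynomials

open MvPolynomial

/-- The alternant, the determinant of the matrix with entries `X i ^ a j`. The exponents are not
required to decrease. -/
noncomputable def alternant (n : ℕ) (a : Fin n → ℕ) : MvPolynomial (Fin n) ℤ :=
  (Matrix.of fun i j => X i ^ a j : Matrix (Fin n) (Fin n) (MvPolynomial (Fin n) ℤ)).det

/-- The Schur polynomial of the partition with row lengths `lam` in `n` variables, as the generating
function of Gelfand-Tsetlin patterns by weight. -/
noncomputable def schurPoly (n : ℕ) (lam : ℕ → ℕ) : MvPolynomial (Fin n) ℤ :=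
  ∑ g : StripChain n 0 lam, ∏ k : Fin n, X k ^ g.weight k

theorem alternant_comp_perm {n : ℕ} (a : Fin n → ℕ) (e : Equiv.Perm (Fin n)) :
    alternant n (a ∘ e) = (Equiv.Perm.sign e : ℤ) * alternant n a := by
  have := Matrix.det_permute' e
    (Matrix.of fun i j => X i ^ a j : Matrix (Fin n) (Fin n) (MvPolynomial (Fin n) ℤ))
  simp only [alternant]
  rw [← this]
  rfl

/-- The staircase partition `(n - 1, …, 1, 0)`. -/
def staircase (n k : ℕ) : ℕ := n - 1 - k

theorem alternant_staircase_ne_zero (n : ℕ) : alternant n (fun k => staircase n k) ≠ 0 := by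
  have h1 : (fun k : Fin n => staircase n k) = (fun k : Fin n => (k : ℕ)) ∘ Fin.revPerm := by
    funext k
    simp only [staircase, Function.comp, Fin.revPerm_apply, Fin.val_rev]
    omega
  rw [h1, alternant_comp_perm]
  refine mul_ne_zero ?_ ?_
  · exact_mod_cast Units.ne_zero _
  · exact Matrix.det_vandermonde_ne_zero_iff.2 (X_injective)

theorem StripChain.weight_eq {n : ℕ} {mu lam : ℕ → ℕ} (g g' : StripChain n mu lam) {k l : ℕ}
    (h : g.tail (k + 1) 0 + g'.tail l 0 = g'.tail (l + 1) 0 + g.tail k 0) :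
    g.weight k = g'.weight l := by
  have h1 := g.tail_add_weight k
  have h2 := g'.tail_add_weight l
  omega

/-- The Bender-Knuth involution on all columns exchanges two neighbouring components of the
weight. -/
theorem rename_swap_schurPoly {n : ℕ} (lam : ℕ → ℕ) {k : ℕ} (hk : k + 1 < n) :
    rename (Equiv.swap (⟨k, by omega⟩ : Fin n) ⟨k + 1, hk⟩) (schurPoly n lam) =
      schurPoly n lam := by
  set e := Equiv.swap (⟨k, by omega⟩ : Fin n) ⟨k + 1, hk⟩ with he
  have hc : ∀ g : StripChain n 0 lam, ∀ i, lam 0 < g.part (k + 1) i → lam 0 < g.part k i := by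
    intro g i hi
    have h1 := g.part_antitone (k + 1) (Nat.zero_le i)
    have h2 := g.part_le_top (k + 1) 0
    omega
  have hinv : Function.Involutive fun g : StripChain n 0 lam => g.toggle k (lam 0) hk (hc g) :=
    fun g => g.toggle_toggle hk (hc g)
  simp only [schurPoly, map_sum, map_prod, map_pow, rename_X]
  refine Fintype.sum_equiv hinv.toPerm _ _ fun g => ?_
  refine Eq.trans ?_ (Equiv.prod_comp e _)
  refine Finset.prod_congr rfl fun l _ => ?_
  congr 1
  have ht : ∀ l, g.tail l (lam 0) = 0 := fun l => Finset.sum_eq_zero fun i _ => by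
    have h1 := g.part_antitone l (Nat.zero_le i)
    have h2 := g.part_le_top l 0
    omega
  have h0 := g.toggle_tail_zero hk (hc g)
  rw [ht, ht, ht] at h0
  change _ = (g.toggle k (lam 0) hk (hc g)).weight (e l)
  have hne : ∀ l, l ≠ k + 1 → (g.toggle k (lam 0) hk (hc g)).tail l 0 = g.tail l 0 :=
    fun l hl => g.toggle_tail_of_ne hk (hc g) hl 0
  have hk0 := hne k (by omega)
  have hk2 := hne (k + 1 + 1) (by omega)
  have hk3 : g.tail (k + 1 + 1) 0 = g.tail (k + 2) 0 := rfl
  by_cases h1 : l = ⟨k, by omega⟩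
  · subst h1
    rw [he, Equiv.swap_apply_left]
    apply StripChain.weight_eq
    simp only
    omega
  · by_cases h2 : l = ⟨k + 1, hk⟩
    · subst h2
      rw [he, Equiv.swap_apply_right]
      apply StripChain.weight_eq
      simp only
      omega
    · rw [he, Equiv.swap_apply_of_ne_of_ne h1 h2]
      have h3 : (l : ℕ) ≠ k := fun h => h1 (Fin.ext h)
      have h4 : (l : ℕ) ≠ k + 1 := fun h => h2 (Fin.ext h)
      apply StripChain.weight_eq
      rw [hne _ h4, hne _ (by omega)]

theorem rename_schurPoly {n : ℕ} (lam : ℕ → ℕ) (e : Equiv.Perm (Fin n)) :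
    rename e (schurPoly n lam) = schurPoly n lam := by
  cases n with
  | zero =>
    rw [Subsingleton.elim e (Equiv.refl _)]
    simp
  | succ n =>
    have he : e ∈ Submonoid.closure (Set.range fun i : Fin n => Equiv.swap i.castSucc i.succ) := by
      rw [Equiv.Perm.mclosure_swap_castSucc_succ]
      exact Submonoid.mem_top e
    induction he using Submonoid.closure_induction with
    | mem x hx =>
      obtain ⟨i, rfl⟩ := hx
      exact rename_swap_schurPoly lam (k := i) (by omega)
    | one => simp
    | mul x y _ _ hx hy =>
      rw [Equiv.Perm.coe_mul, ← rename_rename, hy, hx]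

/-- By the symmetry of the Schur polynomial, its variables may be permuted along with those of each
term of the determinant. -/
theorem alternant_mul_schurPoly {n : ℕ} (a : Fin n → ℕ) (lam : ℕ → ℕ) :
    alternant n a * schurPoly n lam =
      ∑ g : StripChain n 0 lam, alternant n (fun k => a k + g.weight k) := by
  simp only [alternant, Matrix.det_apply, Matrix.of_apply]
  rw [Finset.sum_comm, Finset.sum_mul]
  refine Finset.sum_congr rfl fun e _ => ?_
  rw [← Finset.smul_sum, smul_mul_assoc]
  congr 1
  rw [← rename_schurPoly lam e]
  simp only [schurPoly, map_sum, map_prod, map_pow, rename_X, Finset.mul_sum, pow_add,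
    Finset.prod_mul_distrib]

namespace StripChain

variable {n : ℕ} {lam m : ℕ → ℕ}

/-! ### Cancellation of the chains that are not dominant -/

/-- The failure of dominance for the entries `k + 1`, `k + 2` and the columns from `j` on. -/
def Violates (m : ℕ → ℕ) (g : StripChain n 0 lam) (k j : ℕ) : Prop :=
  k + 1 < n ∧ m k + 2 * g.tail (k + 1) j < m (k + 1) + g.tail (k + 2) j + g.tail k j

/-- The pair `(k, j)` marks the first failure of dominance: the column `j` is the rightmost one
possible, and then `k` is smallest. -/
structure FirstViolation (m : ℕ → ℕ) (g : StripChain n 0 lam) (k j : ℕ) : Prop where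
  violates : g.Violates m k j
  last : ∀ k' j', j < j' → ¬ g.Violates m k' j'
  first : ∀ k' < k, ¬ g.Violates m k' j

theorem FirstViolation.unique {g : StripChain n 0 lam} {k j k' j' : ℕ}
    (h : g.FirstViolation m k j) (h' : g.FirstViolation m k' j') : k = k' ∧ j = j' := by
  have hj : j = j' := by
    rcases lt_trichotomy j j' with hlt | heq | hlt
    · exact absurd h'.violates (h.last _ _ hlt)
    · exact heq
    · exact absurd h.violates (h'.last _ _ hlt)
  subst hj
  refine ⟨?_, rfl⟩
  rcases lt_trichotomy k k' with hlt | heq | hlt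
  · exact absurd h.violates (h'.first _ hlt)
  · exact heq
  · exact absurd h'.violates (h.first _ hlt)

theorem exists_firstViolation (hm : Antitone m) (g : StripChain n 0 lam) (hg : ¬ g.Dominant m) :
    ∃ k j, g.FirstViolation m k j := by
  classical
  have hbound : ∀ k j, g.Violates m k j → j ≤ lam 0 := by
    intro k j h
    by_contra hj
    have h0 : ∀ l, g.tail l j = 0 := fun l => Finset.sum_eq_zero fun i _ => by
      have h1 := g.part_antitone l (Nat.zero_le i)
      have h2 := g.part_le_top l 0
      omega
    have h1 := h.2
    rw [h0, h0, h0] at h1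
    have : m (k + 1) ≤ m k := hm (Nat.le_succ k)
    omega
  have hex : ∃ j ≤ lam 0, ∃ k, g.Violates m k j := by
    simp only [Dominant, not_forall, not_le] at hg
    obtain ⟨k, hk, j, hj⟩ := hg
    exact ⟨j, hbound k j ⟨hk, hj⟩, k, hk, hj⟩
  obtain ⟨j, hjle, hj⟩ := hex
  have hspec := Nat.findGreatest_spec (P := fun j => ∃ k, g.Violates m k j) hjle hj
  refine ⟨Nat.find hspec, _, Nat.find_spec hspec, fun k' j' hlt h => ?_,
    fun k' hk' => Nat.find_min hspec hk'⟩
  exact Nat.findGreatest_is_greatest hlt (hbound k' j' h) ⟨k', h⟩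

theorem FirstViolation.eq_and_cut {g : StripChain n 0 lam} {k j : ℕ}
    (h : g.FirstViolation m k j) :
    m (k + 1) + g.tail (k + 2) j + g.tail k j = m k + 2 * g.tail (k + 1) j + 1 ∧
      ∀ i, j < g.part (k + 1) i → j < g.part k i := by
  refine g.eq_of_violation h.violates.1 h.violates.2 ?_
  by_contra hc
  exact h.last k (j + 1) (Nat.lt_succ_self j) ⟨h.violates.1, not_le.1 hc⟩

/-- Dominance in the columns from `j` on depends only on boxes that the involution leaves alone. -/
theorem FirstViolation.toggle {g : StripChain n 0 lam} {k j : ℕ} (h : g.FirstViolation m k j) :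
    (g.toggle k j h.violates.1 h.eq_and_cut.2).FirstViolation m k j := by
  have key : ∀ k' j', j ≤ j' → ((g.toggle k j h.violates.1 h.eq_and_cut.2).Violates m k' j' ↔
      g.Violates m k' j') := by
    intro k' j' hj
    simp only [Violates, g.toggle_tail h.violates.1 h.eq_and_cut.2 hj]
  exact ⟨(key _ _ le_rfl).2 h.violates, fun k' j' hj => by
    rw [key _ _ hj.le]; exact h.last k' j' hj, fun k' hk => by
    rw [key _ _ le_rfl]; exact h.first k' hk⟩

/-- As dominance fails by exactly one, adding the staircase turns the exchange of entries before
column `j` into a transposition of two exponents of the alternant. -/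
theorem FirstViolation.alternant_toggle {g : StripChain n 0 lam} {k j : ℕ}
    (h : g.FirstViolation m k j) :
    alternant n (fun l => m l + staircase n l +
        (g.toggle k j h.violates.1 h.eq_and_cut.2).weight l) =
      - alternant n (fun l => m l + staircase n l + g.weight l) := by
  have hk := h.violates.1
  obtain ⟨heq, hcut⟩ := h.eq_and_cut
  have hne : (⟨k, by omega⟩ : Fin n) ≠ ⟨k + 1, hk⟩ := fun h => by
    have := congrArg Fin.val h
    simp at this
  have key := alternant_comp_perm (fun l : Fin n => m l + staircase n l + g.weight l)
    (Equiv.swap (⟨k, by omega⟩ : Fin n) ⟨k + 1, hk⟩)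
  rw [Equiv.Perm.sign_swap hne] at key
  simp only [Units.val_neg, Units.val_one, Int.cast_neg, Int.cast_one, neg_mul, one_mul] at key
  rw [← key]
  congr 1
  funext l
  set g' := g.toggle k j h.violates.1 h.eq_and_cut.2 with hg'
  have h0 := g.toggle_tail_zero hk hcut
  rw [← hg'] at h0
  have hne : ∀ l, l ≠ k + 1 → g'.tail l 0 = g.tail l 0 :=
    fun l hl => g.toggle_tail_of_ne hk hcut hl 0
  have hk0 := hne k (by omega)
  have hk2 : g'.tail (k + 1 + 1) 0 = g.tail (k + 2) 0 := hne (k + 1 + 1) (by omega)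
  have w1 := g.tail_add_weight k
  have w2 : _ = g.tail (k + 2) 0 := g.tail_add_weight (k + 1)
  have w3 := g'.tail_add_weight k
  have w4 := g'.tail_add_weight (k + 1)
  simp only [Function.comp]
  by_cases h1 : l = ⟨k, by omega⟩
  · subst h1
    rw [Equiv.swap_apply_left]
    simp only [staircase]
    omega
  · by_cases h2 : l = ⟨k + 1, hk⟩
    · subst h2
      rw [Equiv.swap_apply_right]
      simp only [staircase]
      omega
    · rw [Equiv.swap_apply_of_ne_of_ne h1 h2]
      have h3 : (l : ℕ) ≠ k := fun h => h1 (Fin.ext h)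
      have h4 : (l : ℕ) ≠ k + 1 := fun h => h2 (Fin.ext h)
      congr 1
      apply StripChain.weight_eq
      rw [hne _ h4, hne _ (by omega)]

open Classical in
/-- The sign-reversing involution that cancels the chains which are not dominant: the Bender-Knuth
involution in the columns before the first failure. Dominant chains are fixed. -/
noncomputable def reflect (m : ℕ → ℕ) (g : StripChain n 0 lam) : StripChain n 0 lam :=
  if h : ∃ k j, g.FirstViolation m k j then
    g.toggle h.choose h.choose_spec.choose h.choose_spec.choose_spec.violates.1
      h.choose_spec.choose_spec.eq_and_cut.2
  else g

theorem reflect_eq {g : StripChain n 0 lam} {k j : ℕ} (h : g.FirstViolation m k j) :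
    g.reflect m = g.toggle k j h.violates.1 h.eq_and_cut.2 := by
  have hex : ∃ k j, g.FirstViolation m k j := ⟨k, j, h⟩
  obtain ⟨h1, h2⟩ := h.unique hex.choose_spec.choose_spec
  rw [reflect, dif_pos hex]
  congr 1
  · exact h1.symm
  · exact h2.symm

theorem FirstViolation.not_dominant {g : StripChain n 0 lam} {k j : ℕ}
    (h : g.FirstViolation m k j) : ¬ g.Dominant m := fun hd =>
  absurd (hd k h.violates.1 j) (not_le.2 h.violates.2)

open Classical in
/-- Only the dominant chains contribute to the sum of the alternants. -/
theorem sum_alternant_eq_sum_dominant (hm : Antitone m) :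
    ∑ g : StripChain n 0 lam, alternant n (fun l => m l + staircase n l + g.weight l) =
      ∑ g : StripChain n 0 lam with g.Dominant m,
        alternant n (fun l => m l + staircase n l + g.weight l) := by
  rw [← Finset.sum_filter_add_sum_filter_not Finset.univ (fun g => g.Dominant m)]
  rw [add_eq_left]
  have hkey : ∀ g : StripChain n 0 lam, ¬ g.Dominant m →
      alternant n (fun l => m l + staircase n l + (g.reflect m).weight l) =
        - alternant n (fun l => m l + staircase n l + g.weight l) ∧
      ¬ (g.reflect m).Dominant m ∧ (g.reflect m).reflect m = g := by
    intro g hg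
    obtain ⟨k, j, h⟩ := g.exists_firstViolation hm hg
    rw [reflect_eq h, reflect_eq h.toggle]
    exact ⟨h.alternant_toggle, h.toggle.not_dominant, g.toggle_toggle _ _⟩
  refine Finset.sum_involution (fun g _ => g.reflect m) ?_ ?_ ?_ ?_
  · intro g hg
    rw [(hkey g (Finset.mem_filter.1 hg).2).1, add_neg_cancel]
  · intro g hg h0 heq
    have h1 := (hkey g (Finset.mem_filter.1 hg).2).1
    rw [heq] at h1
    -- a fixed point of the involution has a zero alternant
    exact h0 (self_eq_neg.1 h1)
  · intro g hg
    exact Finset.mem_filter.2 ⟨Finset.mem_univ _, (hkey g (Finset.mem_filter.1 hg).2).2.1⟩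
  · intro g hg
    exact (hkey g (Finset.mem_filter.1 hg).2).2.2

/-- The chain of the tableau in which every box of row `i`, counted from one, has the entry
`i`. -/
def highest (n : ℕ) {lam : ℕ → ℕ} (hl : Antitone lam) (h0 : ∀ i, n ≤ i → lam i = 0) :
    StripChain n 0 lam where
  part k i := if i < k then lam i else 0
  bot i := by simp
  top k i hk := by
    split_ifs with h
    · rfl
    · exact (h0 i (by omega)).symm
  mono k i := by split_ifs <;> omega
  strip k i := by
    have : lam (i + 1) ≤ lam i := hl (Nat.le_succ i)
    split_ifs <;> omega

theorem highest_dominant (hl : Antitone lam) (h0 : ∀ i, n ≤ i → lam i = 0) :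
    (highest n hl h0).Dominant 0 := by
  intro k hk j
  have ht : ∀ l ≤ n, (highest n hl h0).tail l j = ∑ i ∈ Finset.range l, (lam i - j) := by
    intro l hl'
    rw [tail, ← sum_range_ite_lt (n := n) _ hl']
    refine Finset.sum_congr rfl fun i _ => ?_
    simp only [highest]
    split_ifs <;> omega
  rw [ht _ (by omega), ht _ (by omega), ht _ (by omega), Finset.sum_range_succ _ (k + 1),
    Finset.sum_range_succ _ k]
  have : lam (k + 1) ≤ lam k := hl (Nat.le_succ k)
  simp only [Pi.zero_apply]
  omega

theorem highest_weight (hl : Antitone lam) (h0 : ∀ i, n ≤ i → lam i = 0) {k : ℕ} (hk : k < n) :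
    (highest n hl h0).weight k = lam k := by
  rw [weight, Finset.sum_eq_single_of_mem k (Finset.mem_range.2 hk)]
  · simp [highest]
  · intro i _ hi
    simp only [highest]
    split_ifs <;> omega

theorem Dominant.eq_highest {g : StripChain n 0 lam} (hg : g.Dominant 0) (hl : Antitone lam)
    (h0 : ∀ i, n ≤ i → lam i = 0) : g = highest n hl h0 := by
  have hrow := (g.dominant_iff_rows (m := 0) (fun _ _ _ => le_rfl)).1 hg
  have key : ∀ q, ∀ k, q < k → g.part k q = lam q := by
    intro q
    induction q using Nat.strong_induction_on with
    | _ q ih =>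
      intro k hk
      by_cases hq : q < n
      · -- from level `q + 1` on, row `q` does not change
        have hstep : ∀ l, q ≤ l → g.part (l + 2) q = g.part (l + 1) q := by
          intro l hl'
          by_cases hln : l + 1 < n
          · have h1 := hrow l hln q hq
            rw [Finset.sum_range_succ] at h1
            have h2 : ∑ i ∈ Finset.range q, (g.part (l + 1) i - g.part l i) = 0 :=
              Finset.sum_eq_zero fun i hi => by
                have hi := Finset.mem_range.1 hi
                rw [ih i hi _ (by omega), ih i hi _ (by omega), Nat.sub_self]
            have h3 : g.part (l + 1) q ≤ g.part (l + 2) q := g.mono (l + 1) q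
            simp only [Pi.zero_apply] at h1
            omega
          · rw [g.top _ _ (by omega), g.top _ _ (by omega)]
        have hconst : ∀ d, g.part (q + 1 + d) q = g.part (q + 1) q := by
          intro d
          induction d with
          | zero => rfl
          | succ d ihd =>
            have h1 := hstep (q + d) (by omega)
            rw [← ihd, show q + 1 + (d + 1) = q + d + 2 by omega,
              show q + 1 + d = q + d + 1 by omega]
            exact h1
        rw [show k = q + 1 + (k - (q + 1)) by omega, hconst, ← hconst n,
          g.top _ _ (by omega)]
      · rw [h0 q (by omega)]
        have h1 := g.part_le_top k q
        rw [h0 q (by omega)] at h1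
        omega
  ext k i
  simp only [highest]
  split_ifs with h
  · exact key i k h
  · exact g.part_eq_zero (by omega)

end StripChain

/-- The bialternant formula for Schur polynomials. -/
theorem alternant_staircase_mul_schurPoly {n : ℕ} {lam : ℕ → ℕ} (hl : Antitone lam)
    (h0 : ∀ i, n ≤ i → lam i = 0) :
    alternant n (fun k => staircase n k) * schurPoly n lam =
      alternant n (fun k => lam k + staircase n k) := by
  classical
  have h1 := StripChain.sum_alternant_eq_sum_dominant (n := n) (lam := lam) (m := 0)
    (fun _ _ _ => le_rfl)
  simp only [Pi.zero_apply, zero_add] at h1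
  rw [alternant_mul_schurPoly, h1, Finset.sum_eq_single (StripChain.highest n hl h0)]
  · congr 1
    funext k
    rw [StripChain.highest_weight hl h0 k.2, add_comm]
  · intro g hg hne
    exact absurd ((Finset.mem_filter.1 hg).2.eq_highest hl h0) hne
  · intro h
    exact absurd (Finset.mem_filter.2 ⟨Finset.mem_univ _, StripChain.highest_dominant hl h0⟩) h

namespace StripChain

variable {n : ℕ} {lam m : ℕ → ℕ}

theorem weight_eq_zero (g : StripChain n m lam) {k : ℕ} (hk : n ≤ k) : g.weight k = 0 :=
  Finset.sum_eq_zero fun i _ => by rw [g.top _ _ hk, g.top _ _ (by omega), Nat.sub_self]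

theorem Dominant.antitone_add {g : StripChain n 0 lam} (hg : g.Dominant m) (hm : Antitone m) :
    Antitone fun k => m k + g.weight k := by
  refine antitone_nat_of_succ_le fun k => ?_
  have h0 : m (k + 1) ≤ m k := hm (Nat.le_succ k)
  by_cases hk : k + 1 < n
  · have h1 := hg k hk 0
    have w1 := g.tail_add_weight k
    have w2 : _ = g.tail (k + 2) 0 := g.tail_add_weight (k + 1)
    omega
  · rw [g.weight_eq_zero (k := k + 1) (by omega)]
    omega

end StripChain

open Classical in
/-- The Littlewood-Richardson rule in the form of a sum over the tableaux of shape `nu` that are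
dominant relative to `mu`. -/
theorem schurPoly_mul_schurPoly {n : ℕ} {mu nu : ℕ → ℕ} (hmu : Antitone mu)
    (hmu0 : ∀ i, n ≤ i → mu i = 0) :
    schurPoly n mu * schurPoly n nu =
      ∑ g : StripChain n 0 nu with g.Dominant mu, schurPoly n (fun k => mu k + g.weight k) := by
  refine mul_left_cancel₀ (alternant_staircase_ne_zero n) ?_
  rw [← mul_assoc, alternant_staircase_mul_schurPoly hmu hmu0, alternant_mul_schurPoly,
    StripChain.sum_alternant_eq_sum_dominant hmu, Finset.mul_sum]
  refine Finset.sum_congr rfl fun g hg => ?_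
  rw [alternant_staircase_mul_schurPoly ((Finset.mem_filter.1 hg).2.antitone_add hmu)
    (fun i hi => by rw [hmu0 i hi, g.weight_eq_zero hi])]
  congr 1
  funext k
  omega

/-- The coefficients of a generating function count the objects of given weight. -/
theorem coeff_sum_prod_X {n : ℕ} {ι : Type*} [Fintype ι] (w : ι → ℕ → ℕ) (b : ℕ → ℕ) :
    coeff (Finsupp.equivFunOnFinite.symm fun k : Fin n => b k)
      (∑ x : ι, ∏ k : Fin n, (X k : MvPolynomial (Fin n) ℤ) ^ w x k) =
        Nat.card {x : ι // ∀ k < n, w x k = b k} := by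
  classical
  have h : ∀ x, ∏ k : Fin n, (X k : MvPolynomial (Fin n) ℤ) ^ w x k =
      monomial (Finsupp.equivFunOnFinite.symm fun k : Fin n => w x k) 1 := by
    intro x
    rw [monomial_eq, Finsupp.prod_fintype _ _ (fun _ => pow_zero _)]
    simp
  simp only [h, coeff_sum, coeff_monomial]
  rw [Finset.sum_boole, Nat.card_eq_fintype_card, Fintype.card_subtype]
  congr 2
  ext x
  simp only [Finset.mem_filter, Finset.mem_univ, true_and, EmbeddingLike.apply_eq_iff_eq,
    funext_iff, Fin.forall_iff]

open Classical in
/-- Comparison of coefficients in `schurPoly_mul_schurPoly`. -/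
theorem card_pairs_eq_sum {n : ℕ} {mu nu : ℕ → ℕ} (hmu : Antitone mu)
    (hmu0 : ∀ i, n ≤ i → mu i = 0) (b : ℕ → ℕ) :
    Nat.card {x : StripChain n 0 mu × StripChain n 0 nu //
        ∀ k < n, x.1.weight k + x.2.weight k = b k} =
      ∑ g : StripChain n 0 nu with g.Dominant mu,
        Nat.card {x : StripChain n 0 (fun k => mu k + g.weight k) //
          ∀ k < n, x.weight k = b k} := by
  have h := congrArg (coeff (Finsupp.equivFunOnFinite.symm fun k : Fin n => b k))
    (schurPoly_mul_schurPoly (nu := nu) hmu hmu0)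
  simp only [schurPoly, coeff_sum, Fintype.sum_mul_sum, ← Fintype.sum_prod_type',
    ← Finset.prod_mul_distrib, ← pow_add] at h
  have h1 := coeff_sum_prod_X (n := n)
    (fun (x : StripChain n 0 mu × StripChain n 0 nu) k => x.1.weight k + x.2.weight k) b
  have h2 := fun g : StripChain n 0 nu => coeff_sum_prod_X (n := n)
    (fun (x : StripChain n 0 (fun k => mu k + g.weight k)) k => x.weight k) b
  simp only [coeff_sum] at h1 h2
  simp only [h1, h2] at h
  exact_mod_cast h

end Polynomials

/-! ### Tableaux as chains of horizontal strips -/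

namespace SkewSSYT

variable {lam mu : YoungDiagram}

theorem entry_mono (T : SkewSSYT lam mu) {i j₁ j₂ : ℕ} (h : j₁ ≤ j₂) (h₂ : j₂ < lam.rowLen i) :
    T.entry i j₁ ≤ T.entry i j₂ := by
  rcases h.eq_or_lt with rfl | hlt
  · exact le_rfl
  · by_cases hmu : (i, j₁) ∈ mu
    · rw [T.zeros i j₁ (Or.inr hmu)]
      exact Nat.zero_le _
    · exact T.row_weak i j₁ j₂ hlt hmu (YoungDiagram.mem_iff_lt_rowLen.2 h₂)

/-- The length of row `i` of the partition formed by `mu` and the boxes with entries at most `v`. As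
the entries vanish on `mu`, the boxes of `mu` need not be mentioned. -/
def rowCount (T : SkewSSYT lam mu) (v i : ℕ) : ℕ :=
  ((Finset.range (lam.rowLen i)).filter fun j => T.entry i j ≤ v).card

theorem rowCount_le (T : SkewSSYT lam mu) (v i : ℕ) : T.rowCount v i ≤ lam.rowLen i :=
  (Finset.card_filter_le _ _).trans (Finset.card_range _).le

theorem lt_rowCount_iff (T : SkewSSYT lam mu) {v i j : ℕ} (hj : j < lam.rowLen i) :
    j < T.rowCount v i ↔ T.entry i j ≤ v := by
  refine ⟨fun h => ?_, fun h => ?_⟩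
  · by_contra hc
    have hsub : (Finset.range (lam.rowLen i)).filter (fun j => T.entry i j ≤ v) ⊆
        Finset.range j := by
      intro x hx
      obtain ⟨hx1, hx2⟩ := Finset.mem_filter.1 hx
      rw [Finset.mem_range] at hx1 ⊢
      by_contra hxj
      have := T.entry_mono (not_lt.1 hxj) hx1
      omega
    have := Finset.card_le_card hsub
    rw [Finset.card_range] at this
    exact absurd h (not_lt.2 this)
  · have hsub : Finset.range (j + 1) ⊆
        (Finset.range (lam.rowLen i)).filter (fun j => T.entry i j ≤ v) := by
      intro x hx
      rw [Finset.mem_range] at hx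
      have := T.entry_mono (Nat.lt_succ_iff.1 hx) hj
      exact Finset.mem_filter.2 ⟨Finset.mem_range.2 (by omega), this.trans h⟩
    have := Finset.card_le_card hsub
    rw [Finset.card_range] at this
    exact this

theorem rowCount_eq (T : SkewSSYT lam mu) {v i x : ℕ} (hx : x ≤ lam.rowLen i)
    (h : ∀ j < lam.rowLen i, j < x ↔ T.entry i j ≤ v) : T.rowCount v i = x := by
  have hle := T.rowCount_le v i
  rcases lt_trichotomy (T.rowCount v i) x with hlt | heq | hlt
  · have h1 := (h _ (hlt.trans_le hx)).1 hlt
    rw [← T.lt_rowCount_iff (hlt.trans_le hx)] at h1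
    omega
  · exact heq
  · have h1 := (T.lt_rowCount_iff (hlt.trans_le hle)).1 hlt
    rw [← h _ (hlt.trans_le hle)] at h1
    omega

theorem rowCount_mono (T : SkewSSYT lam mu) {v w : ℕ} (h : v ≤ w) (i : ℕ) :
    T.rowCount v i ≤ T.rowCount w i :=
  Finset.card_le_card fun _ hx => Finset.mem_filter.2
    ⟨(Finset.mem_filter.1 hx).1, (Finset.mem_filter.1 hx).2.trans h⟩

theorem _root_.YoungDiagram.rowLen_mono {mu lam : YoungDiagram} (h : mu ≤ lam) (i : ℕ) :
    mu.rowLen i ≤ lam.rowLen i := by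
  by_contra! hc
  have h1 : (i, lam.rowLen i) ∈ mu := YoungDiagram.mem_iff_lt_rowLen.2 hc
  exact absurd (YoungDiagram.mem_iff_lt_rowLen.1 (h h1)) (lt_irrefl _)

/-- The chain of horizontal strips encoding a tableau with entries at most `n`. The function `m`
stands for the row lengths of `mu`; it is separate because for `mu = ⊥` these are zero only
propositionally. -/
def chain (T : SkewSSYT lam mu) (hle : mu ≤ lam) {n : ℕ} (hn : ∀ i j, T.entry i j ≤ n)
    {m : ℕ → ℕ} (hm : ∀ i, mu.rowLen i = m i) : StripChain n m lam.rowLen where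
  part := T.rowCount
  bot i := T.rowCount_eq ((hm i).symm.trans_le (YoungDiagram.rowLen_mono hle i)) fun j hj => by
    rw [← hm, ← YoungDiagram.mem_iff_lt_rowLen, Nat.le_zero]
    refine ⟨fun h => T.zeros i j (Or.inr h), fun h => ?_⟩
    by_contra hc
    exact (T.pos i j (YoungDiagram.mem_iff_lt_rowLen.2 hj) hc).ne' h
  top k i hk := T.rowCount_eq le_rfl fun j hj => ⟨fun _ => (hn i j).trans hk, fun _ => hj⟩
  mono k i := T.rowCount_mono (Nat.le_succ k) i
  strip k i := by
    by_contra! hc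
    have h1 := T.rowCount_le (k + 1) (i + 1)
    have h2 := lam.rowLen_anti i (i + 1) (Nat.le_succ i)
    have h3 := (T.lt_rowCount_iff (hc.trans_le h1)).1 hc
    have h4 := mt (T.lt_rowCount_iff (hc.trans_le (h1.trans h2))).2 (lt_irrefl _)
    by_cases hmu : (i, T.rowCount k i) ∈ mu
    · rw [T.zeros _ _ (Or.inr hmu)] at h4
      omega
    · have := T.col_strict i (i + 1) _ (Nat.lt_succ_self i) hmu
        (YoungDiagram.mem_iff_lt_rowLen.2 (hc.trans_le h1))
      omega

/-- The number of boxes with entry `v + 1`; the shift excludes the boxes of `mu`. -/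
def content (T : SkewSSYT lam mu) (v : ℕ) : ℕ :=
  (lam.cells.filter fun c => T.entry c.1 c.2 = v + 1).card

theorem card_row_filter (T : SkewSSYT lam mu) (v i : ℕ) :
    ((Finset.range (lam.rowLen i)).filter fun j => T.entry i j = v + 1).card =
      T.rowCount (v + 1) i - T.rowCount v i := by
  have h : (Finset.range (lam.rowLen i)).filter (fun j => T.entry i j ≤ v + 1) =
      (Finset.range (lam.rowLen i)).filter (fun j => T.entry i j ≤ v) ∪
        (Finset.range (lam.rowLen i)).filter (fun j => T.entry i j = v + 1) := by
    ext j
    simp only [Finset.mem_union, Finset.mem_filter]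
    rw [← and_or_left]
    refine and_congr_right fun _ => ?_
    omega
  have hd : Disjoint ((Finset.range (lam.rowLen i)).filter (fun j => T.entry i j ≤ v))
      ((Finset.range (lam.rowLen i)).filter (fun j => T.entry i j = v + 1)) := by
    rw [Finset.disjoint_filter]
    intro j _ h1 h2
    omega
  have h2 := Finset.card_union_of_disjoint hd
  rw [← h] at h2
  simp only [rowCount]
  omega

theorem content_eq_sum (T : SkewSSYT lam mu) {n : ℕ} (hn : lam.colLen 0 ≤ n) (v : ℕ) :
    T.content v = ∑ i ∈ Finset.range n, (T.rowCount (v + 1) i - T.rowCount v i) := by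
  rw [content, Finset.card_eq_sum_card_fiberwise (f := Prod.fst) (t := Finset.range n)]
  · refine Finset.sum_congr rfl fun i _ => ?_
    rw [← T.card_row_filter]
    refine (Finset.card_bij (fun j _ => (i, j)) ?_ ?_ ?_).symm
    · intro j hj
      simp only [Finset.mem_filter, Finset.mem_range] at hj
      simp only [Finset.mem_filter, YoungDiagram.mem_cells, and_true]
      exact ⟨YoungDiagram.mem_iff_lt_rowLen.2 hj.1, hj.2⟩
    · intro j _ j' _ h
      exact (Prod.mk.inj h).2
    · rintro ⟨i', j⟩ hc
      simp only [Finset.mem_filter, YoungDiagram.mem_cells] at hc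
      obtain ⟨⟨hc1, hc2⟩, rfl⟩ := hc
      exact ⟨j, Finset.mem_filter.2
        ⟨Finset.mem_range.2 (YoungDiagram.mem_iff_lt_rowLen.1 hc1), hc2⟩, rfl⟩
  · rintro ⟨i, j⟩ hc
    have hc1 : (i, j) ∈ lam := (YoungDiagram.mem_cells _).1 (Finset.mem_filter.1 hc).1
    have hc2 : (i, 0) ∈ lam := lam.up_left_mem le_rfl (Nat.zero_le j) hc1
    have := YoungDiagram.mem_iff_lt_colLen.1 hc2
    simp only [Finset.coe_range, Set.mem_Iio]
    omega

theorem hasWeight_iff (T : SkewSSYT lam mu) (nu : YoungDiagram) :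
    T.HasWeight nu ↔ ∀ v, T.content v = nu.rowLen v := by
  refine forall_congr' fun v => ?_
  rw [content]
  congr! 2
  ext ⟨i, j⟩
  simp only [Finset.mem_filter, Finset.mem_sdiff, and_congr_left_iff, and_iff_left_iff_imp]
  intro h _ hmu
  rw [T.zeros i j (Or.inr ((YoungDiagram.mem_cells _).1 hmu))] at h
  omega

end SkewSSYT

namespace StripChain

variable {lam mu : YoungDiagram} {n : ℕ} {m : ℕ → ℕ}

/-- The entry in box `(i, j)` of the tableau encoded by `P`: the number of partitions of the chain
that do not yet contain the box. -/
def entry (P : StripChain n m lam.rowLen) (i j : ℕ) : ℕ :=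
  if j < lam.rowLen i then ((Finset.range n).filter fun v => P.part v i ≤ j).card else 0

theorem entry_le_iff (P : StripChain n m lam.rowLen) {i j v : ℕ} (hj : j < lam.rowLen i) :
    P.entry i j ≤ v ↔ j < P.part v i := by
  rw [entry, if_pos hj]
  refine ⟨fun h => ?_, fun h => ?_⟩
  · by_contra! hc
    have hv : v < n := by
      by_contra! hv
      rw [P.top v i hv] at hc
      omega
    have hsub : Finset.range (v + 1) ⊆ (Finset.range n).filter fun v => P.part v i ≤ j := by
      intro w hw
      rw [Finset.mem_range] at hw
      have : P.part w i ≤ P.part v i := P.part_le_part i (show w ≤ v by omega)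
      exact Finset.mem_filter.2 ⟨Finset.mem_range.2 (by omega), this.trans hc⟩
    have := Finset.card_le_card hsub
    rw [Finset.card_range] at this
    omega
  · have hsub : ((Finset.range n).filter fun v => P.part v i ≤ j) ⊆ Finset.range v := by
      intro w hw
      rw [Finset.mem_range]
      by_contra! hc
      have h1 : P.part v i ≤ P.part w i := P.part_le_part i hc
      have h2 := (Finset.mem_filter.1 hw).2
      omega
    have := Finset.card_le_card hsub
    rwa [Finset.card_range] at this

theorem entry_le (P : StripChain n m lam.rowLen) (i j : ℕ) : P.entry i j ≤ n := by
  rw [entry]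
  split_ifs
  · exact (Finset.card_filter_le _ _).trans (Finset.card_range n).le
  · exact Nat.zero_le n

/-- The skew tableau encoded by a chain of horizontal strips. -/
def tableau (P : StripChain n m lam.rowLen) (hm : ∀ i, mu.rowLen i = m i) : SkewSSYT lam mu where
  entry := P.entry
  row_weak i j₁ j₂ h _ h₂ := by
    have h2 := YoungDiagram.mem_iff_lt_rowLen.1 h₂
    rw [P.entry_le_iff (h.trans h2)]
    exact h.trans ((P.entry_le_iff h2).1 le_rfl)
  col_strict i₁ i₂ j h h₁ h₂ := by
    have h2 := YoungDiagram.mem_iff_lt_rowLen.1 h₂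
    have h1 : j < lam.rowLen i₁ := h2.trans_le (lam.rowLen_anti i₁ i₂ h.le)
    have h3 := (P.entry_le_iff h2).1 le_rfl
    rw [YoungDiagram.mem_iff_lt_rowLen, hm, ← P.bot, not_lt] at h₁
    obtain ⟨w, hw⟩ : ∃ w, P.entry i₂ j = w + 1 := by
      refine Nat.exists_eq_succ_of_ne_zero fun h0 => ?_
      rw [h0] at h3
      have := P.part_antitone 0 h.le
      omega
    rw [hw] at h3 ⊢
    rw [Nat.lt_succ_iff, P.entry_le_iff h1]
    have h4 := P.strip w i₁
    have h5 := P.part_antitone (w + 1) (show i₁ + 1 ≤ i₂ from h)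
    omega
  pos i j h h' := by
    refine Nat.pos_of_ne_zero fun h0 => h' ?_
    rwa [← Nat.le_zero, P.entry_le_iff (YoungDiagram.mem_iff_lt_rowLen.1 h), P.bot, ← hm,
      ← YoungDiagram.mem_iff_lt_rowLen] at h0
  zeros i j h := by
    by_cases hj : j < lam.rowLen i
    · rw [← Nat.le_zero, P.entry_le_iff hj, P.bot, ← hm, ← YoungDiagram.mem_iff_lt_rowLen]
      exact h.resolve_left (not_not.2 (YoungDiagram.mem_iff_lt_rowLen.2 hj))
    · rw [entry, if_neg hj]

/-- Skew tableaux with entries at most `n` correspond to chains of horizontal strips. -/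
def tableauEquiv (hle : mu ≤ lam) (n : ℕ) {m : ℕ → ℕ} (hm : ∀ i, mu.rowLen i = m i) :
    {T : SkewSSYT lam mu // ∀ i j, T.entry i j ≤ n} ≃ StripChain n m lam.rowLen where
  toFun T := T.1.chain hle T.2 hm
  invFun P := ⟨P.tableau hm, P.entry_le⟩
  left_inv T := by
    refine Subtype.ext (SkewSSYT.ext (funext fun i => funext fun j => ?_))
    by_cases hj : j < lam.rowLen i
    · refine eq_of_forall_ge_iff fun v => ?_
      exact (entry_le_iff _ hj).trans (T.1.lt_rowCount_iff hj)
    · rw [T.1.zeros i j (Or.inl (mt YoungDiagram.mem_iff_lt_rowLen.1 hj))]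
      exact if_neg hj
  right_inv P := by
    ext v i
    exact (P.tableau hm).rowCount_eq (P.part_le_top v i) fun j hj => (P.entry_le_iff hj).symm

theorem weight_tableauEquiv (hle : mu ≤ lam) {n : ℕ} (hn : lam.colLen 0 ≤ n) {m : ℕ → ℕ}
    (hm : ∀ i, mu.rowLen i = m i) (T : {T : SkewSSYT lam mu // ∀ i j, T.entry i j ≤ n}) (v : ℕ) :
    (tableauEquiv hle n hm T).weight v = T.1.content v :=
  (T.1.content_eq_sum hn v).symm

end StripChain

/-! ### Companion tableaux -/

section Companion

variable {n : ℕ} {mu nu lam : ℕ → ℕ}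

namespace StripChain

/-- The reverse reading word of the tableau encoded by `P` is a lattice word, tested at the ends of
rows: the rows up to `k` contain at most as many entries `r + 2` as the rows before `k` contain
entries `r + 1`. -/
def IsLattice (P : StripChain n mu lam) : Prop :=
  ∀ r, ∀ k < n, ∑ i ∈ Finset.range (k + 1), (P.part (r + 2) i - P.part (r + 1) i) ≤
    ∑ i ∈ Finset.range k, (P.part (r + 1) i - P.part r i)

theorem sum_range_part_sub_level (g : StripChain n mu lam) (k r : ℕ) :
    ∑ i ∈ Finset.range k, (g.part (i + 1) r - g.part i r) = g.part k r - mu r := by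
  rw [Finset.sum_range_tsub (g.part_le_part r), g.bot]

theorem sum_range_eq_weight (hl : ∀ i, n ≤ i → lam i = 0) (P : StripChain n mu lam) {k : ℕ}
    (hk : n ≤ k) (r : ℕ) :
    ∑ i ∈ Finset.range k, (P.part (r + 1) i - P.part r i) = P.weight r := by
  refine (Finset.sum_subset (Finset.range_mono hk) fun i _ hi => ?_).symm
  have h := P.part_le_top (r + 1) i
  rw [hl i (by simpa using hi)] at h
  omega

/-- The companion of a Littlewood-Richardson tableau: row `r` of the companion contains the entry
`i + 1` as often as row `i` of the tableau contains the entry `r + 1`. The lattice condition becomes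
semistandardness of the companion. -/
def companion (hl : ∀ i, n ≤ i → lam i = 0) (hnu : Antitone nu) (P : StripChain n mu lam)
    (hw : ∀ k, P.weight k = nu k) (hP : P.IsLattice) : StripChain n 0 nu where
  part k r := ∑ i ∈ Finset.range k, (P.part (r + 1) i - P.part r i)
  bot r := Finset.sum_range_zero _
  top k r hk := (P.sum_range_eq_weight hl hk r).trans (hw r)
  mono k r := Finset.sum_le_sum_of_subset (Finset.range_mono (Nat.le_succ k))
  strip k r := by
    by_cases hk : k < n
    · exact hP r k hk
    · rw [P.sum_range_eq_weight hl (by omega), P.sum_range_eq_weight hl (by omega), hw, hw]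
      exact hnu (Nat.le_succ r)

theorem companion_part_sub (hl : ∀ i, n ≤ i → lam i = 0) (hnu : Antitone nu)
    (P : StripChain n mu lam) (hw : ∀ k, P.weight k = nu k) (hP : P.IsLattice) (k r : ℕ) :
    (P.companion hl hnu hw hP).part (k + 1) r - (P.companion hl hnu hw hP).part k r =
      P.part (r + 1) k - P.part r k := by
  simp only [companion]
  rw [Finset.sum_range_succ, Nat.add_sub_cancel_left]

/-- Dominance of the companion, read by rows, is the strictness of the columns of the original
tableau. -/
theorem companion_dominant (hl : ∀ i, n ≤ i → lam i = 0) (hmu : Antitone mu) (hnu : Antitone nu)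
    (P : StripChain n mu lam) (hw : ∀ k, P.weight k = nu k) (hP : P.IsLattice) :
    (P.companion hl hnu hw hP).Dominant mu := by
  rw [dominant_iff_rows hmu]
  intro k _ q _
  simp only [companion_part_sub, show ∀ l, (P.companion hl hnu hw hP).part (l + 2) =
    (P.companion hl hnu hw hP).part (l + 1 + 1) from fun _ => rfl]
  rw [sum_range_part_sub_level, sum_range_part_sub_level]
  have h1 := P.strip q k
  have h2 := P.bot_le_part (q + 1) (k + 1)
  have h3 := P.bot_le_part q k
  omega

theorem companion_weight (hl : ∀ i, n ≤ i → lam i = 0) (hnu : Antitone nu)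
    (P : StripChain n mu lam) (hw : ∀ k, P.weight k = nu k) (hP : P.IsLattice) (k : ℕ) :
    mu k + (P.companion hl hnu hw hP).weight k = lam k := by
  rw [weight]
  simp only [companion_part_sub]
  rw [sum_range_part_sub_level, P.top n k le_rfl]
  have := P.bot_le_part n k
  rw [P.top n k le_rfl] at this
  omega

/-- The chain from `mu` to `lam` whose companion is the dominant chain `g`. -/
def cocompanion (hla : Antitone lam) (hmu : Antitone mu)
    (g : StripChain n 0 nu) (hw : ∀ k, mu k + g.weight k = lam k) (hg : g.Dominant mu) :
    StripChain n mu lam where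
  part r i := mu i + ∑ r' ∈ Finset.range r, (g.part (i + 1) r' - g.part i r')
  bot i := by simp
  top r i hr := by
    rw [g.sum_range_eq_weight (fun i hi => g.top_eq_zero hi) hr, hw]
  mono r i := Nat.add_le_add_left
    (Finset.sum_le_sum_of_subset (Finset.range_mono (Nat.le_succ r))) _
  strip r i := by
    by_cases hr : r < n
    · by_cases hi : i + 1 < n
      · exact (dominant_iff_rows hmu g).1 hg i hi r hr
      · rw [Finset.sum_eq_zero (s := Finset.range (r + 1)), add_zero]
        · exact (hmu (Nat.le_succ i)).trans (Nat.le_add_right _ _)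
        · intro r' _
          rw [g.top _ _ (by omega), g.top _ _ (by omega), Nat.sub_self]
    · rw [g.sum_range_eq_weight (fun i hi => g.top_eq_zero hi) (by omega),
        g.sum_range_eq_weight (fun i hi => g.top_eq_zero hi) (by omega), hw, hw]
      exact hla (Nat.le_succ i)

theorem cocompanion_part_sub (hla : Antitone lam)
    (hmu : Antitone mu) (g : StripChain n 0 nu) (hw : ∀ k, mu k + g.weight k = lam k)
    (hg : g.Dominant mu) (r i : ℕ) :
    (g.cocompanion hla hmu hw hg).part (r + 1) i - (g.cocompanion hla hmu hw hg).part r i =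
      g.part (i + 1) r - g.part i r := by
  simp only [cocompanion]
  rw [Finset.sum_range_succ]
  omega

theorem cocompanion_weight (hla : Antitone lam)
    (hmu : Antitone mu) (g : StripChain n 0 nu) (hw : ∀ k, mu k + g.weight k = lam k)
    (hg : g.Dominant mu) (r : ℕ) : (g.cocompanion hla hmu hw hg).weight r = nu r := by
  rw [weight]
  simp only [cocompanion_part_sub]
  rw [sum_range_part_sub_level, g.top n r le_rfl]
  rfl

theorem cocompanion_isLattice (hla : Antitone lam)
    (hmu : Antitone mu) (g : StripChain n 0 nu) (hw : ∀ k, mu k + g.weight k = lam k)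
    (hg : g.Dominant mu) : (g.cocompanion hla hmu hw hg).IsLattice := by
  intro r k _
  simp only [cocompanion_part_sub, show ∀ l, (g.cocompanion hla hmu hw hg).part (l + 2) =
    (g.cocompanion hla hmu hw hg).part (l + 1 + 1) from fun _ => rfl]
  rw [sum_range_part_sub_level, sum_range_part_sub_level]
  exact g.strip k r

/-- Littlewood-Richardson tableaux of shape `lam / mu` and weight `nu` correspond to the tableaux of
shape `nu` that are dominant relative to `mu` and lead from `mu` to `lam`. -/
def companionEquiv (hl : ∀ i, n ≤ i → lam i = 0) (hla : Antitone lam) (hmu : Antitone mu)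
    (hnu : Antitone nu) :
    {P : StripChain n mu lam // (∀ k, P.weight k = nu k) ∧ P.IsLattice} ≃
      {g : StripChain n 0 nu // g.Dominant mu ∧ ∀ k, mu k + g.weight k = lam k} where
  toFun P := ⟨P.1.companion hl hnu P.2.1 P.2.2, P.1.companion_dominant hl hmu hnu P.2.1 P.2.2,
    P.1.companion_weight hl hnu P.2.1 P.2.2⟩
  invFun g := ⟨g.1.cocompanion hla hmu g.2.2 g.2.1,
    g.1.cocompanion_weight hla hmu g.2.2 g.2.1,
    g.1.cocompanion_isLattice hla hmu g.2.2 g.2.1⟩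
  left_inv P := by
    refine Subtype.ext (StripChain.ext (funext fun r => funext fun i => ?_))
    change mu i + ∑ r' ∈ Finset.range r, (_ - _) = _
    simp only [companion_part_sub]
    rw [sum_range_part_sub_level]
    have := P.1.bot_le_part r i
    omega
  right_inv g := by
    refine Subtype.ext (StripChain.ext (funext fun k => funext fun r => ?_))
    change ∑ i ∈ Finset.range k, (_ - _) = _
    simp only [cocompanion_part_sub]
    rw [sum_range_part_sub_level]
    rfl

end StripChain

end Companion

/-! ### Yamanouchi words -/

section Words

/-- In a weakly increasing word, some final segment contains all letters `i + 1` and no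
letter `i`. -/
theorem exists_drop_count {l : List ℕ} (hl : l.Pairwise (· ≤ ·)) (i : ℕ) :
    ∃ j, (l.drop j).count (i + 1) = l.count (i + 1) ∧ (l.drop j).count i = 0 := by
  induction l with
  | nil => exact ⟨0, by simp⟩
  | cons x l ih =>
    rw [List.pairwise_cons] at hl
    by_cases hx : x ≤ i
    · obtain ⟨j, h1, h2⟩ := ih hl.2
      refine ⟨j + 1, ?_, ?_⟩
      · rw [List.drop_succ_cons, h1, List.count_cons_of_ne (by omega)]
      · rw [List.drop_succ_cons, h2]
    · refine ⟨0, rfl, ?_⟩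
      rw [List.drop_zero, List.count_eq_zero]
      intro hi
      rcases List.mem_cons.1 hi with rfl | hi
      · exact hx le_rfl
      · have := hl.1 i hi
        omega

theorem isYamanouchi_append_iff {l w : List ℕ} (hl : l.Pairwise (· ≤ ·)) :
    IsYamanouchi (l ++ w) ↔ IsYamanouchi w ∧
      ∀ i, 1 ≤ i → l.count (i + 1) + w.count (i + 1) ≤ w.count i := by
  refine ⟨fun h => ⟨fun i j hi => ?_, fun i hi => ?_⟩, fun h i j hi => ?_⟩
  · have := h i (l.length + j) hi
    rwa [← List.drop_drop, List.drop_left] at this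
  · obtain ⟨j, h1, h2⟩ := exists_drop_count hl i
    by_cases hj : j ≤ l.length
    · have := h i j hi
      rw [List.drop_append_of_le_length hj, List.count_append, List.count_append, h1, h2] at this
      omega
    · have h3 : l.drop j = [] := List.drop_eq_nil_of_le (by omega)
      rw [h3] at h1
      have := h i l.length hi
      rw [List.drop_left] at this
      rw [← h1]
      simpa using this
  · by_cases hj : j ≤ l.length
    · rw [List.drop_append_of_le_length hj, List.count_append, List.count_append]
      have h1 := h.2 i hi
      have h2 : (l.drop j).count (i + 1) ≤ l.count (i + 1) :=
        (List.drop_sublist j l).count_le _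
      omega
    · rw [show j = l.length + (j - l.length) by omega, ← List.drop_drop, List.drop_left]
      exact h.1 i _ hi

theorem count_flatMap_reverse_range (f : ℕ → List ℕ) (a k : ℕ) :
    ((List.range k).reverse.flatMap f).count a = ∑ i ∈ Finset.range k, (f i).count a := by
  induction k with
  | zero => rfl
  | succ k ih =>
    rw [List.range_succ, List.reverse_append, List.reverse_singleton, List.singleton_append,
      List.flatMap_cons, List.count_append, ih, Finset.sum_range_succ, add_comm]

theorem isYamanouchi_flatMap_iff {f : ℕ → List ℕ} (hf : ∀ i, (f i).Pairwise (· ≤ ·)) (n : ℕ) :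
    IsYamanouchi ((List.range n).reverse.flatMap f) ↔
      ∀ k < n, ∀ i, 1 ≤ i → ∑ t ∈ Finset.range (k + 1), (f t).count (i + 1) ≤
        ∑ t ∈ Finset.range k, (f t).count i := by
  induction n with
  | zero =>
    simp [IsYamanouchi]
  | succ n ih =>
    rw [List.range_succ, List.reverse_append, List.reverse_singleton, List.singleton_append,
      List.flatMap_cons, isYamanouchi_append_iff (hf n), ih, Nat.forall_lt_succ_right]
    refine and_congr_right fun _ => forall₂_congr fun i _ => ?_
    rw [count_flatMap_reverse_range, count_flatMap_reverse_range, Finset.sum_range_succ, add_comm]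

end Words

namespace SkewSSYT

variable {lam mu : YoungDiagram}

/-- The part of the reading word that comes from row `i`. -/
def rowWord (T : SkewSSYT lam mu) (i : ℕ) : List ℕ :=
  (List.range' (mu.rowLen i) (lam.rowLen i - mu.rowLen i)).map fun j => T.entry i j

theorem rowWord_pairwise (T : SkewSSYT lam mu) (i : ℕ) : (T.rowWord i).Pairwise (· ≤ ·) := by
  rw [rowWord, List.pairwise_map]
  refine (List.pairwise_lt_range' (s := mu.rowLen i)
    (n := lam.rowLen i - mu.rowLen i)).imp_of_mem fun {a b} ha hb hab => ?_
  rw [List.mem_range'_1] at hb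
  exact T.entry_mono hab.le (by omega)

theorem count_rowWord (T : SkewSSYT lam mu) (i v : ℕ) :
    (T.rowWord i).count (v + 1) = T.rowCount (v + 1) i - T.rowCount v i := by
  rw [← T.card_row_filter, rowWord, List.count, List.countP_map]
  have h1 : ((Finset.range (lam.rowLen i)).filter fun j => T.entry i j = v + 1) =
      (Finset.Ico (mu.rowLen i) (lam.rowLen i)).filter fun j => T.entry i j = v + 1 := by
    ext j
    simp only [Finset.mem_filter, Finset.mem_range, Finset.mem_Ico]
    refine ⟨fun h => ⟨⟨?_, h.1⟩, h.2⟩, fun h => ⟨h.1.2, h.2⟩⟩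
    by_contra! hc
    have := T.zeros i j (Or.inr (YoungDiagram.mem_iff_lt_rowLen.2 hc))
    omega
  rw [h1, List.countP_eq_length_filter]
  simp only [Finset.card, Finset.filter, Finset.Ico, LocallyFiniteOrder.finsetIco,
    Multiset.filter_coe, Multiset.coe_card]
  congr 2

theorem readingWord_eq (T : SkewSSYT lam mu) {n : ℕ} (hn : lam.colLen 0 ≤ n) :
    T.readingWord = (List.range n).reverse.flatMap T.rowWord := by
  induction n, hn using Nat.le_induction with
  | base => rfl
  | succ n hn ih =>
    rw [List.range_succ, List.reverse_append, List.reverse_singleton, List.singleton_append,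
      List.flatMap_cons, ← ih]
    have h0 : lam.rowLen n = 0 := by
      by_contra hc
      have := YoungDiagram.mem_iff_lt_colLen.1
        (YoungDiagram.mem_iff_lt_rowLen.2 (Nat.pos_of_ne_zero hc))
      omega
    simp [rowWord, h0]

theorem isYamanouchi_iff (T : SkewSSYT lam mu) {n : ℕ} (hn : lam.colLen 0 ≤ n) :
    IsYamanouchi T.readingWord ↔ ∀ r, ∀ k < n,
      ∑ i ∈ Finset.range (k + 1), (T.rowCount (r + 2) i - T.rowCount (r + 1) i) ≤
        ∑ i ∈ Finset.range k, (T.rowCount (r + 1) i - T.rowCount r i) := by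
  rw [T.readingWord_eq hn, isYamanouchi_flatMap_iff T.rowWord_pairwise]
  refine ⟨fun h r k hk => ?_, fun h k hk i hi => ?_⟩
  · have := h k hk (r + 1) (by omega)
    simpa only [count_rowWord] using this
  · obtain ⟨r, rfl⟩ : ∃ r, i = r + 1 := ⟨i - 1, by omega⟩
    simpa only [count_rowWord] using h r k hk

end SkewSSYT

/-! ### Counting tableaux by content -/

section Count

theorem YoungDiagram.rowLen_eq_zero {lam : YoungDiagram} {n i : ℕ} (hn : lam.colLen 0 ≤ n)
    (hi : n ≤ i) : lam.rowLen i = 0 := by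
  by_contra hc
  have := YoungDiagram.mem_iff_lt_colLen.1
    (YoungDiagram.mem_iff_lt_rowLen.2 (Nat.pos_of_ne_zero hc))
  omega

theorem YoungDiagram.rowLen_antitone (lam : YoungDiagram) : Antitone lam.rowLen :=
  fun i j h => lam.rowLen_anti i j h

/-- The tableaux counted by a Littlewood-Richardson coefficient correspond to dominant chains. -/
noncomputable def lrEquiv {mu nu lam : YoungDiagram} (hle : mu ≤ lam) {n : ℕ}
    (hlam : lam.colLen 0 ≤ n) (hnu : nu.colLen 0 ≤ n) :
    LRTableau mu nu lam ≃ {g : StripChain n 0 nu.rowLen // g.Dominant mu.rowLen ∧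
      ∀ k, mu.rowLen k + g.weight k = lam.rowLen k} := by
  refine Equiv.trans ?_ (StripChain.companionEquiv (mu := mu.rowLen) (lam := lam.rowLen)
    (fun i hi => YoungDiagram.rowLen_eq_zero hlam hi) lam.rowLen_antitone mu.rowLen_antitone
    nu.rowLen_antitone)
  let e := StripChain.tableauEquiv hle n (fun _ => rfl)
  have h1 : ∀ T : {T : SkewSSYT lam mu // ∀ i j, T.entry i j ≤ n},
      (T.1.HasWeight nu ∧ IsYamanouchi T.1.readingWord) ↔
        (∀ k, (e T).weight k = nu.rowLen k) ∧ (e T).IsLattice := by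
    intro T
    rw [T.1.hasWeight_iff, T.1.isYamanouchi_iff hlam]
    refine and_congr (forall_congr' fun v => ?_) Iff.rfl
    rw [StripChain.weight_tableauEquiv hle hlam]
  refine Equiv.trans ?_ (e.subtypeEquiv h1)
  exact
    { toFun := fun T => ⟨⟨T.1, fun i j => (T.1.entry_le T.2.1 i j).trans hnu⟩, T.2⟩
      invFun := fun T => ⟨T.1.1, T.2⟩
      left_inv := fun T => rfl
      right_inv := fun T => rfl }

/-- The number of boxes with entry `v`. -/
def PosSSYT.content {lam : YoungDiagram} (M : PosSSYT lam) (v : ℕ) : ℕ :=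
  (lam.cells.filter fun c => M.1 c.1 c.2 = v).card

/-- Tableaux of straight shape are skew tableaux with an empty inner shape. -/
def PosSSYT.toSkew {lam : YoungDiagram} : PosSSYT lam ≃ SkewSSYT lam ⊥ where
  toFun M :=
    { entry := M.1
      row_weak := fun _ _ _ h _ h' => M.1.row_weak h h'
      col_strict := fun _ _ _ h _ h' => M.1.col_strict h h'
      pos := fun _ _ h _ => M.2 _ _ h
      zeros := fun _ _ h => M.1.zeros (h.resolve_right (YoungDiagram.notMem_bot _)) }
  invFun T := ⟨{ entry := T.entry
                 row_weak' := fun h h' => T.row_weak _ _ _ h (YoungDiagram.notMem_bot _) h'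
                 col_strict' := fun h h' => T.col_strict _ _ _ h (YoungDiagram.notMem_bot _) h'
                 zeros' := fun h => T.zeros _ _ (Or.inl h) },
    fun i j h => T.pos i j h (YoungDiagram.notMem_bot _)⟩
  left_inv _ := rfl
  right_inv _ := rfl

theorem YoungDiagram.rowLen_bot (i : ℕ) : (⊥ : YoungDiagram).rowLen i = (0 : ℕ → ℕ) i := by
  by_contra hc
  exact YoungDiagram.notMem_bot _ (YoungDiagram.mem_iff_lt_rowLen.2 (Nat.pos_of_ne_zero hc))

/-- Tableaux with entries at most `n` correspond to Gelfand-Tsetlin patterns. -/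
def boundedEquiv (lam : YoungDiagram) (n : ℕ) :
    {M : PosSSYT lam // ∀ i j, M.1 i j ≤ n} ≃ StripChain n 0 lam.rowLen :=
  (PosSSYT.toSkew.subtypeEquiv fun _ => Iff.rfl).trans
    (StripChain.tableauEquiv bot_le n YoungDiagram.rowLen_bot)

theorem weight_boundedEquiv {lam : YoungDiagram} {n : ℕ} (hn : lam.colLen 0 ≤ n)
    (M : {M : PosSSYT lam // ∀ i j, M.1 i j ≤ n}) (v : ℕ) :
    (boundedEquiv lam n M).weight v = M.1.content (v + 1) :=
  StripChain.weight_tableauEquiv bot_le hn YoungDiagram.rowLen_bot _ v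

theorem PosSSYT.le_of_content_eq_zero {lam : YoungDiagram} (M : PosSSYT lam) {n : ℕ}
    (h : ∀ v, n < v → M.content v = 0) (i j : ℕ) : M.1 i j ≤ n := by
  by_contra! hc
  have hmem : (i, j) ∈ lam := by
    by_contra hm
    rw [M.1.zeros hm] at hc
    omega
  have h1 := h _ hc
  rw [PosSSYT.content, Finset.card_eq_zero] at h1
  have : (i, j) ∈ lam.cells.filter fun c => M.1 c.1 c.2 = M.1 i j :=
    Finset.mem_filter.2 ⟨(YoungDiagram.mem_cells _).2 hmem, rfl⟩
  rw [h1] at this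
  exact absurd this (Finset.notMem_empty _)

theorem PosSSYT.content_zero {lam : YoungDiagram} (M : PosSSYT lam) : M.content 0 = 0 := by
  rw [PosSSYT.content, Finset.card_eq_zero, Finset.filter_eq_empty_iff]
  rintro ⟨i, j⟩ hc
  exact (M.2 i j ((YoungDiagram.mem_cells _).1 hc)).ne'

theorem PosSSYT.content_eq_zero {lam : YoungDiagram} (M : PosSSYT lam) {n : ℕ}
    (h : ∀ i j, M.1 i j ≤ n) {v : ℕ} (hv : n < v) : M.content v = 0 := by
  rw [PosSSYT.content, Finset.card_eq_zero, Finset.filter_eq_empty_iff]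
  intro c _ hc
  have := h c.1 c.2
  omega

/-- The content `b` belongs to entries in `{1, …, n}` only. -/
def SupportedIn (n : ℕ) (b : ℕ → ℕ) : Prop := b 0 = 0 ∧ ∀ v, n < v → b v = 0

/-- Tableaux of given content correspond to patterns of given weight. -/
def contentFiberEquiv {lam : YoungDiagram} {n : ℕ} (hn : lam.colLen 0 ≤ n) {b : ℕ → ℕ}
    (hb : SupportedIn n b) :
    {M : PosSSYT lam // M.content = b} ≃
      {g : StripChain n 0 lam.rowLen // ∀ k < n, g.weight k = b (k + 1)} where
  toFun M := ⟨boundedEquiv lam n ⟨M.1, M.1.le_of_content_eq_zero fun v hv => by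
    rw [M.2]; exact hb.2 v hv⟩, fun k _ => by rw [weight_boundedEquiv hn]; exact congrFun M.2 _⟩
  invFun g := ⟨((boundedEquiv lam n).symm g.1).1, by
    have h := weight_boundedEquiv hn ((boundedEquiv lam n).symm g.1)
    funext v
    rcases Nat.eq_zero_or_pos v with rfl | hv
    · rw [PosSSYT.content_zero, hb.1]
    · by_cases hvn : n < v
      · rw [hb.2 v hvn, PosSSYT.content_eq_zero _ ((boundedEquiv lam n).symm g.1).2 hvn]
      · obtain ⟨k, rfl⟩ : ∃ k, v = k + 1 := ⟨v - 1, by omega⟩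
        rw [← h, Equiv.apply_symm_apply]
        exact g.2 k (by omega)⟩
  left_inv M := by simp
  right_inv g := by simp

/-- Pairs of tableaux of given total content correspond to pairs of patterns of given total
weight. -/
def contentPairFiberEquiv {mu nu : YoungDiagram} {n : ℕ} (hmu : mu.colLen 0 ≤ n)
    (hnu : nu.colLen 0 ≤ n) {b : ℕ → ℕ} (hb : SupportedIn n b) :
    {x : PosSSYT mu × PosSSYT nu // x.1.content + x.2.content = b} ≃
      {x : StripChain n 0 mu.rowLen × StripChain n 0 nu.rowLen //
        ∀ k < n, x.1.weight k + x.2.weight k = b (k + 1)} where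
  toFun x :=
    ⟨(boundedEquiv mu n ⟨x.1.1, x.1.1.le_of_content_eq_zero fun v hv => by
        have h1 := congrFun x.2 v
        rw [hb.2 v hv, Pi.add_apply] at h1
        omega⟩,
      boundedEquiv nu n ⟨x.1.2, x.1.2.le_of_content_eq_zero fun v hv => by
        have h1 := congrFun x.2 v
        rw [hb.2 v hv, Pi.add_apply] at h1
        omega⟩), fun k _ => by
      rw [weight_boundedEquiv hmu, weight_boundedEquiv hnu]
      exact congrFun x.2 _⟩
  invFun x := ⟨(((boundedEquiv mu n).symm x.1.1).1, ((boundedEquiv nu n).symm x.1.2).1), by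
    have h := weight_boundedEquiv hmu ((boundedEquiv mu n).symm x.1.1)
    have h' := weight_boundedEquiv hnu ((boundedEquiv nu n).symm x.1.2)
    funext v
    rw [Pi.add_apply]
    rcases Nat.eq_zero_or_pos v with rfl | hv
    · rw [PosSSYT.content_zero, PosSSYT.content_zero, hb.1]
    · by_cases hvn : n < v
      · rw [hb.2 v hvn, PosSSYT.content_eq_zero _ ((boundedEquiv mu n).symm x.1.1).2 hvn,
          PosSSYT.content_eq_zero _ ((boundedEquiv nu n).symm x.1.2).2 hvn]
      · obtain ⟨k, rfl⟩ : ∃ k, v = k + 1 := ⟨v - 1, by omega⟩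
        rw [← h, ← h', Equiv.apply_symm_apply, Equiv.apply_symm_apply]
        exact x.2 k (by omega)⟩
  left_inv x := by simp
  right_inv x := by simp

theorem PosSSYT.exists_supportedIn {lam : YoungDiagram} (M : PosSSYT lam) :
    ∃ n, SupportedIn n M.content := by
  refine ⟨lam.cells.sup fun c => M.1 c.1 c.2, M.content_zero, fun v hv => ?_⟩
  rw [PosSSYT.content, Finset.card_eq_zero, Finset.filter_eq_empty_iff]
  intro c hc hcv
  have := Finset.le_sup (f := fun c : ℕ × ℕ => M.1 c.1 c.2) hc
  omega

theorem SupportedIn.mono {n n' : ℕ} {b : ℕ → ℕ} (h : SupportedIn n b) (hn : n ≤ n') :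
    SupportedIn n' b :=
  ⟨h.1, fun v hv => h.2 v (by omega)⟩

theorem YoungDiagram.rowLen_injective : Function.Injective YoungDiagram.rowLen := by
  intro lam lam' h
  ext ⟨i, j⟩
  rw [YoungDiagram.mem_cells, YoungDiagram.mem_cells, YoungDiagram.mem_iff_lt_rowLen,
    YoungDiagram.mem_iff_lt_rowLen, h]

theorem YoungDiagram.exists_rowLen_eq {f : ℕ → ℕ} (hf : Antitone f) {n : ℕ}
    (h0 : ∀ i, n ≤ i → f i = 0) : ∃ lam : YoungDiagram, lam.rowLen = f := by
  let lam : YoungDiagram :=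
    { cells := (Finset.range n ×ˢ Finset.range (f 0)).filter fun c => c.2 < f c.1
      isLowerSet := by
        rintro ⟨i, j⟩ ⟨i', j'⟩ hle h
        simp only [Finset.coe_filter, Finset.mem_product, Finset.mem_range, Set.mem_ofPred_eq]
          at h ⊢
        have h1 : i' ≤ i := hle.1
        have h2 : j' ≤ j := hle.2
        have h3 := hf h1
        omega }
  have hmem : ∀ i j, (i, j) ∈ lam ↔ j < f i := by
    intro i j
    rw [← YoungDiagram.mem_cells]
    simp only [lam, Finset.mem_filter, Finset.mem_product, Finset.mem_range]
    refine ⟨fun h => h.2, fun h => ⟨⟨?_, ?_⟩, h⟩⟩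
    · by_contra! hc
      rw [h0 i hc] at h
      omega
    · exact h.trans_le (hf (Nat.zero_le i))
  refine ⟨lam, funext fun i => eq_of_forall_lt_iff fun j => ?_⟩
  rw [← hmem, YoungDiagram.mem_iff_lt_rowLen]

theorem YoungDiagram.card_eq_sum_rowLen {lam : YoungDiagram} {n : ℕ}
    (hn : ∀ i, n ≤ i → lam.rowLen i = 0) : lam.card = ∑ i ∈ Finset.range n, lam.rowLen i := by
  rw [YoungDiagram.card, Finset.card_eq_sum_card_fiberwise (f := Prod.fst) (t := Finset.range n)]
  · refine Finset.sum_congr rfl fun i _ => ?_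
    rw [YoungDiagram.rowLen_eq_card]
    rfl
  · rintro ⟨i, j⟩ hc
    have h := YoungDiagram.mem_iff_lt_rowLen.1 ((YoungDiagram.mem_cells _).1 hc)
    simp only [Finset.coe_range, Set.mem_Iio]
    by_contra! hi
    rw [hn i hi] at h
    omega

theorem StripChain.sum_weight {n : ℕ} {nu : ℕ → ℕ} (g : StripChain n 0 nu) :
    ∑ k ∈ Finset.range n, g.weight k = ∑ i ∈ Finset.range n, nu i := by
  simp only [StripChain.weight]
  rw [Finset.sum_comm]
  refine Finset.sum_congr rfl fun i _ => ?_
  rw [g.sum_range_part_sub_level, g.top n i le_rfl]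
  rfl

/-- A dominant chain leads from `mu` to a partition of the right size. -/
theorem exists_skewExtension {mu nu : YoungDiagram} {n : ℕ} (hmu : mu.colLen 0 ≤ n)
    (g : StripChain n 0 nu.rowLen) (hg : g.Dominant mu.rowLen) :
    ∃ lam : SkewExtension mu nu, lam.1.rowLen = fun k => mu.rowLen k + g.weight k := by
  have h0 : ∀ i, n ≤ i → mu.rowLen i + g.weight i = 0 := fun i hi => by
    rw [YoungDiagram.rowLen_eq_zero hmu hi, g.weight_eq_zero hi]
  obtain ⟨lam, hlam⟩ := YoungDiagram.exists_rowLen_eq (hg.antitone_add mu.rowLen_antitone) h0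
  have hle : mu ≤ lam := by
    rintro ⟨i, j⟩ hc
    have h1 := YoungDiagram.mem_iff_lt_rowLen.1 hc
    refine YoungDiagram.mem_iff_lt_rowLen.2 ?_
    rw [hlam]
    exact h1.trans_le (Nat.le_add_right _ _)
  refine ⟨⟨lam, hle, ?_⟩, hlam⟩
  have h1 := Finset.card_sdiff_add_card_eq_card (YoungDiagram.cells_subset_iff.2 hle)
  have h2 : lam.card = mu.card + nu.card := by
    rw [YoungDiagram.card_eq_sum_rowLen (n := n) (fun i hi => by rw [hlam]; exact h0 i hi),
      YoungDiagram.card_eq_sum_rowLen (lam := mu) (n := n)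
        (fun i hi => YoungDiagram.rowLen_eq_zero hmu hi),
      YoungDiagram.card_eq_sum_rowLen (lam := nu) (n := n) (fun i hi => g.top_eq_zero hi),
      hlam, Finset.sum_add_distrib, g.sum_weight]
  simp only [YoungDiagram.card] at h2 ⊢
  omega

/-- A partition `lam`, a Littlewood-Richardson tableau of shape `lam / mu`, and a tableau of shape
`lam`. -/
abbrev LRPair (mu nu : YoungDiagram) : Type :=
  Σ lam : SkewExtension mu nu, LRTableau mu nu lam.1 × PosSSYT lam.1

/-- The content constraint concerns only the last component. -/
def lrPairFiberEquiv (mu nu : YoungDiagram) (b : ℕ → ℕ) :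
    {y : LRPair mu nu // y.2.2.content = b} ≃
      Σ lam : SkewExtension mu nu,
        LRTableau mu nu lam.1 × {M : PosSSYT lam.1 // M.content = b} where
  toFun y := ⟨y.1.1, y.1.2.1, y.1.2.2, y.2⟩
  invFun y := ⟨⟨y.1, y.2.1, y.2.2.1⟩, y.2.2.2⟩
  left_inv _ := rfl
  right_inv _ := rfl

open Classical in
theorem card_pairs_eq_sum_skewExtension {mu nu : YoungDiagram} {n : ℕ} (hmu : mu.colLen 0 ≤ n)
    (hnu : nu.colLen 0 ≤ n) (hlam : ∀ lam : SkewExtension mu nu, lam.1.colLen 0 ≤ n) (b : ℕ → ℕ) :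
    Nat.card {x : StripChain n 0 mu.rowLen × StripChain n 0 nu.rowLen //
        ∀ k < n, x.1.weight k + x.2.weight k = b k} =
      ∑ lam : SkewExtension mu nu, littlewoodRichardson mu nu lam.1 *
        Nat.card {x : StripChain n 0 lam.1.rowLen // ∀ k < n, x.weight k = b k} := by
  rw [card_pairs_eq_sum mu.rowLen_antitone (fun i hi => YoungDiagram.rowLen_eq_zero hmu hi)]
  have h1 : ∀ lam : SkewExtension mu nu, littlewoodRichardson mu nu lam.1 =
      ∑ g : StripChain n 0 nu.rowLen with g.Dominant mu.rowLen,
        if lam.1.rowLen = fun k => mu.rowLen k + g.weight k then 1 else 0 := by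
    intro lam
    rw [littlewoodRichardson, Nat.card_congr (lrEquiv lam.2.1 (hlam lam) hnu),
      Nat.card_eq_fintype_card, Fintype.card_subtype, Finset.sum_boole, Finset.filter_filter,
      Nat.cast_id]
    congr 1
    ext g
    simp only [Finset.mem_filter, funext_iff, eq_comm]
  simp only [h1, Finset.sum_mul]
  rw [Finset.sum_comm]
  refine Finset.sum_congr rfl fun g hg => ?_
  obtain ⟨lam, h⟩ := exists_skewExtension hmu g (Finset.mem_filter.1 hg).2
  rw [Finset.sum_eq_single lam]
  · rw [if_pos h, one_mul, h]
  · intro lam' _ hne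
    rw [if_neg, zero_mul]
    intro h'
    exact hne (Subtype.ext (YoungDiagram.rowLen_injective (h'.trans h.symm)))
  · intro h
    exact absurd (Finset.mem_univ _) h

/-- For each content, both sides of the Littlewood-Richardson rule count equally many objects. The
count takes place among tableaux with entries at most `n`, with `n` so large that nothing of that
content is lost and that all partitions involved have at most `n` rows. -/
theorem nonempty_fiber_equiv (mu nu : YoungDiagram) (b : ℕ → ℕ) :
    Nonempty ({x : PosSSYT mu × PosSSYT nu // x.1.content + x.2.content = b} ≃
      {y : LRPair mu nu // y.2.2.content = b}) := by
  by_cases hb : ∃ n, SupportedIn n b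
  · obtain ⟨n₀, hb⟩ := hb
    obtain ⟨n, h1, h2, h3, h4⟩ : ∃ n, n₀ ≤ n ∧ mu.colLen 0 ≤ n ∧ nu.colLen 0 ≤ n ∧
        ∀ lam : SkewExtension mu nu, lam.1.colLen 0 ≤ n := by
      refine ⟨n₀ + mu.colLen 0 + nu.colLen 0 +
        Finset.univ.sup fun lam : SkewExtension mu nu => lam.1.colLen 0, ?_, ?_, ?_, fun lam => ?_⟩
      · omega
      · omega
      · omega
      · have := Finset.le_sup (f := fun lam : SkewExtension mu nu => lam.1.colLen 0)
          (Finset.mem_univ lam)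
        omega
    replace hb := hb.mono h1
    have e1 := contentPairFiberEquiv h2 h3 hb
    have e2 := lrPairFiberEquiv mu nu b
    have hfin : ∀ lam : SkewExtension mu nu, Finite {M : PosSSYT lam.1 // M.content = b} :=
      fun lam => Finite.of_equiv _ (contentFiberEquiv (h4 lam) hb).symm
    have : Finite {y : LRPair mu nu // y.2.2.content = b} := Finite.of_equiv _ e2.symm
    have : Finite {x : PosSSYT mu × PosSSYT nu // x.1.content + x.2.content = b} :=
      Finite.of_equiv _ e1.symm
    rw [← Finite.card_eq, Nat.card_congr e1, Nat.card_congr e2,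
      card_pairs_eq_sum_skewExtension h2 h3 h4 (fun k => b (k + 1)), Nat.card_sigma]
    refine Finset.sum_congr rfl fun lam _ => ?_
    rw [Nat.card_prod, Nat.card_congr (contentFiberEquiv (h4 lam) hb)]
    rfl
  · have i1 : IsEmpty {x : PosSSYT mu × PosSSYT nu // x.1.content + x.2.content = b} := by
      refine ⟨fun x => hb ?_⟩
      obtain ⟨n, hn⟩ := x.1.1.exists_supportedIn
      obtain ⟨n', hn'⟩ := x.1.2.exists_supportedIn
      refine ⟨max n n', ?_⟩
      have h1 := hn.mono (le_max_left n n')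
      have h2 := hn'.mono (le_max_right n n')
      rw [← x.2]
      exact ⟨by rw [Pi.add_apply, h1.1, h2.1],
        fun v hv => by rw [Pi.add_apply, h1.2 v hv, h2.2 v hv]⟩
    have i2 : IsEmpty {y : LRPair mu nu // y.2.2.content = b} := by
      refine ⟨fun y => hb ?_⟩
      rw [← y.2]
      exact y.1.2.2.exists_supportedIn
    exact ⟨Equiv.equivOfIsEmpty _ _⟩

/-- The Littlewood-Richardson rule as a bijection: fibrewise over the contents, sets of equal finite
cardinality are matched. -/
theorem exists_content_preserving_equiv (mu nu : YoungDiagram) :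
    ∃ e : PosSSYT mu × PosSSYT nu ≃ LRPair mu nu,
      ∀ x, (e x).2.2.content = x.1.content + x.2.content := by
  let f : PosSSYT mu × PosSSYT nu → ℕ → ℕ := fun x => x.1.content + x.2.content
  let h : LRPair mu nu → ℕ → ℕ := fun y => y.2.2.content
  let E : ∀ b, {x // f x = b} ≃ {y // h y = b} := fun b => (nonempty_fiber_equiv mu nu b).some
  refine ⟨(Equiv.sigmaFiberEquiv f).symm.trans
    ((Equiv.sigmaCongrRight E).trans (Equiv.sigmaFiberEquiv h)), fun x => ?_⟩
  exact (E (f x) ⟨x, rfl⟩).2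

end Count

/-! ### Convergence and symmetrization -/

section Analytic

/-- Two functions taking every value equally often differ by a bijection of their domains. -/
theorem exists_equiv_of_card_fiber {A B D : Type*} [Fintype A] [Fintype B] [DecidableEq D]
    (f : A → D) (f' : B → D)
    (h : ∀ v, (Finset.univ.filter fun a => f a = v).card =
      (Finset.univ.filter fun b => f' b = v).card) : ∃ e : A ≃ B, ∀ a, f' (e a) = f a := by
  have h' : ∀ v, Nonempty ({a // f a = v} ≃ {b // f' b = v}) := fun v => by
    rw [← Fintype.card_eq, Fintype.card_subtype, Fintype.card_subtype, h v]
  let E : ∀ v, {a // f a = v} ≃ {b // f' b = v} := fun v => (h' v).some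
  refine ⟨(Equiv.sigmaFiberEquiv f).symm.trans
    ((Equiv.sigmaCongrRight E).trans (Equiv.sigmaFiberEquiv f')), fun x => ?_⟩
  exact (E (f x) ⟨x, rfl⟩).2

/-- A finite set of functions lies in a box, over which the sum factors into partial sums of the
given series. -/
theorem summable_prod_pi {C : Type*} [Fintype C] {g : C → ℕ → ℝ} (h0 : ∀ c m, 0 ≤ g c m)
    (hg : ∀ c, Summable (g c)) : Summable fun f : C → ℕ => ∏ c, g c (f c) := by
  classical
  refine summable_of_sum_le (c := ∏ c, ∑' m, g c m)
    (fun f => Finset.prod_nonneg fun c _ => h0 c _) fun S => ?_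
  let N : ℕ := S.sup fun f => Finset.univ.sup f
  have hS : S ⊆ Fintype.piFinset fun _ : C => Finset.range (N + 1) := by
    intro f hf
    rw [Fintype.mem_piFinset]
    intro c
    have h1 := Finset.le_sup (f := fun f : C → ℕ => Finset.univ.sup f) hf
    have h2 := Finset.le_sup (f := f) (Finset.mem_univ c)
    exact Finset.mem_range.2 (Nat.lt_succ_of_le (h2.trans h1))
  calc ∑ f ∈ S, ∏ c, g c (f c)
      ≤ ∑ f ∈ Fintype.piFinset fun _ : C => Finset.range (N + 1), ∏ c, g c (f c) :=
        Finset.sum_le_sum_of_subset_of_nonneg hS fun f _ _ => Finset.prod_nonneg fun c _ => h0 c _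
    _ = ∏ c, ∑ m ∈ Finset.range (N + 1), g c m := (Finset.prod_univ_sum _ _).symm
    _ ≤ ∏ c, ∑' m, g c m :=
        Finset.prod_le_prod (fun c _ => Finset.sum_nonneg fun m _ => h0 c m)
          fun c _ => (hg c).sum_le_tsum _ fun m _ => h0 c m

/-- The filling `M` as a function on the boxes. -/
def PosSSYT.box {lam : YoungDiagram} (M : PosSSYT lam) (c : lam.cells) : ℕ := M.1 c.1.1 c.1.2

theorem PosSSYT.box_injective (lam : YoungDiagram) :
    Function.Injective (PosSSYT.box (lam := lam)) := by
  intro M M' h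
  refine Subtype.ext (SemistandardYoungTableau.ext fun i j => ?_)
  by_cases hc : (i, j) ∈ lam
  · exact congrFun h ⟨(i, j), (YoungDiagram.mem_cells _).2 hc⟩
  · rw [M.1.zeros hc, M'.1.zeros hc]

theorem PosSSYT.card_box_fiber {lam : YoungDiagram} (M : PosSSYT lam) (v : ℕ) :
    (Finset.univ.filter fun c => M.box c = v).card = M.content v := by
  rw [PosSSYT.content]
  refine Finset.card_bij (fun c _ => c.1) (fun c hc => ?_) (fun _ _ _ _ h => Subtype.ext h)
    fun c hc => ?_
  · exact Finset.mem_filter.2 ⟨c.2, (Finset.mem_filter.1 hc).2⟩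
  · obtain ⟨h1, h2⟩ := Finset.mem_filter.1 hc
    exact ⟨⟨c, h1⟩, Finset.mem_filter.2 ⟨Finset.mem_univ _, h2⟩, rfl⟩

theorem norm_schurZetaTerm {lam : YoungDiagram} (s : lam.cells → ℂ) (M : PosSSYT lam) :
    ‖schurZetaTerm lam s M‖ = ∏ c, 1 / (M.box c : ℝ) ^ (s c).re := by
  rw [schurZetaTerm, norm_div, norm_one, norm_prod, Finset.prod_div_distrib, Finset.prod_const_one]
  congr 1
  refine Finset.prod_congr rfl fun c _ => ?_
  exact Complex.norm_natCast_cpow_of_pos (M.2 _ _ ((YoungDiagram.mem_cells _).1 c.2)) _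

theorem summable_norm_schurZetaTerm {lam : YoungDiagram} {s : lam.cells → ℂ}
    (hs : ∀ c, 1 < (s c).re) : Summable fun M => ‖schurZetaTerm lam s M‖ := by
  simp only [norm_schurZetaTerm]
  exact (summable_prod_pi (g := fun (c : lam.cells) m => 1 / (m : ℝ) ^ (s c).re)
    (fun c m => by positivity) (fun c => Real.summable_one_div_nat_rpow.2 (hs c))).comp_injective
      (PosSSYT.box_injective lam)

theorem summable_norm_lrPair {mu nu : YoungDiagram}
    {f : ∀ lam : SkewExtension mu nu, PosSSYT lam.1 → ℂ}
    (hf : ∀ lam, Summable fun M => ‖f lam M‖) :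
    Summable fun y : LRPair mu nu => ‖f y.1 y.2.2‖ := by
  rw [summable_sigma_of_nonneg fun _ => norm_nonneg _]
  refine ⟨fun lam => ?_, Summable.of_finite⟩
  have := Fintype.ofFinite (LRTableau mu nu lam.1)
  rw [summable_prod_of_nonneg fun _ => norm_nonneg _]
  exact ⟨fun _ => hf lam, Summable.of_finite⟩

/-- Since the terms do not involve the Littlewood-Richardson tableau, it contributes the factor
`littlewoodRichardson mu nu lam`. -/
theorem tsum_lrPair {mu nu : YoungDiagram} {f : ∀ lam : SkewExtension mu nu, PosSSYT lam.1 → ℂ}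
    (hf : ∀ lam, Summable fun M => ‖f lam M‖) :
    ∑' y : LRPair mu nu, f y.1 y.2.2 =
      ∑ lam : SkewExtension mu nu, (littlewoodRichardson mu nu lam.1 : ℂ) * ∑' M, f lam M := by
  have h := (summable_norm_lrPair hf).of_norm
  rw [h.tsum_sigma, tsum_fintype]
  refine Finset.sum_congr rfl fun lam _ => ?_
  have := Fintype.ofFinite (LRTableau mu nu lam.1)
  rw [(h.sigma_factor lam).tsum_prod, tsum_fintype]
  change ∑ _T : LRTableau mu nu lam.1, ∑' M, f lam M = _
  rw [Finset.sum_const, Finset.card_univ,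
    littlewoodRichardson, Nat.card_eq_fintype_card, nsmul_eq_mul]

/-- The symmetrized term depends only on how often each integer occurs as a base: a bijection
between the positions that preserves the bases is absorbed by the permutation. -/
theorem sum_perm_term_eq {V : Type*} [Fintype V] [DecidableEq V] {C : Type*} [Fintype C]
    (v : V → ℂ) (F : V → ℕ) (F' : C → ℕ) (u : C ≃ V)
    (h : ∀ m, (Finset.univ.filter fun c => F' c = m).card =
      (Finset.univ.filter fun d => F d = m).card) :
    ∑ σ : Equiv.Perm V, 1 / ∏ c, (F' c : ℂ) ^ v (σ (u c)) =
      ∑ σ : Equiv.Perm V, 1 / ∏ d, (F d : ℂ) ^ v (σ d) := by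
  obtain ⟨e, he⟩ := exists_equiv_of_card_fiber F' F h
  refine Fintype.sum_equiv (Equiv.mulRight (e.symm.trans u)) _ _ fun σ => ?_
  congr 1
  refine Fintype.prod_equiv e _ _ fun c => ?_
  simp [he]

end Analytic

theorem theorem5p1 (mu nu : YoungDiagram) (s : mu.cells → ℂ) (t : nu.cells → ℂ)
    (hs : ∀ c : mu.cells, 1 < (s c).re) (ht : ∀ c : nu.cells, 1 < (t c).re)
    (u : ∀ lam : SkewExtension mu nu, lam.1.cells ≃ mu.cells ⊕ nu.cells) :
    (∀ σ : Equiv.Perm (mu.cells ⊕ nu.cells),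
      Summable (schurZetaTerm mu fun c => Sum.elim s t (σ (Sum.inl c))) ∧
      Summable (schurZetaTerm nu fun c => Sum.elim s t (σ (Sum.inr c))) ∧
      ∀ lam : SkewExtension mu nu,
        Summable (schurZetaTerm lam.1 fun c => Sum.elim s t (σ (u lam c)))) ∧
    ∑ σ : Equiv.Perm (mu.cells ⊕ nu.cells),
        schurZeta mu (fun c => Sum.elim s t (σ (Sum.inl c))) *
          schurZeta nu (fun c => Sum.elim s t (σ (Sum.inr c))) =
      ∑ σ : Equiv.Perm (mu.cells ⊕ nu.cells), ∑ lam : SkewExtension mu nu,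
        (littlewoodRichardson mu nu lam.1 : ℂ) *
          schurZeta lam.1 (fun c => Sum.elim s t (σ (u lam c))) := by
  have hv : ∀ d, 1 < (Sum.elim s t d).re := by
    rintro (c | c)
    · exact hs c
    · exact ht c
  have hmu := fun σ : Equiv.Perm (mu.cells ⊕ nu.cells) =>
    summable_norm_schurZetaTerm fun c => hv (σ (Sum.inl c))
  have hnu := fun σ : Equiv.Perm (mu.cells ⊕ nu.cells) =>
    summable_norm_schurZetaTerm fun c => hv (σ (Sum.inr c))
  have hlam := fun (σ : Equiv.Perm (mu.cells ⊕ nu.cells)) (lam : SkewExtension mu nu) =>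
    summable_norm_schurZetaTerm fun c => hv (σ (u lam c))
  refine ⟨fun σ => ⟨(hmu σ).of_norm, (hnu σ).of_norm, fun lam => (hlam σ lam).of_norm⟩, ?_⟩
  obtain ⟨e, he⟩ := exists_content_preserving_equiv mu nu
  simp only [schurZeta]
  simp only [← tsum_lrPair (hlam _),
    fun σ => tsum_mul_tsum_of_summable_norm (hmu σ) (hnu σ)]
  rw [← Summable.tsum_finsetSum fun σ _ => summable_mul_of_summable_norm (hmu σ) (hnu σ),
    ← Summable.tsum_finsetSum fun σ _ => (summable_norm_lrPair (hlam σ)).of_norm,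
    ← e.tsum_eq]
  refine tsum_congr fun x => ?_
  have key := sum_perm_term_eq (Sum.elim s t) (Sum.elim x.1.box x.2.box) (e x).2.2.box
    (u (e x).1) fun m => by
      rw [PosSSYT.card_box_fiber, he, Pi.add_apply, ← PosSSYT.card_box_fiber,
        ← PosSSYT.card_box_fiber]
      simp only [Finset.card_filter, Fintype.sum_sum_type, Sum.elim_inl, Sum.elim_inr]
      rfl
  refine Eq.trans ?_ key.symm
  refine Finset.sum_congr rfl fun σ _ => ?_
  rw [Fintype.prod_sum_type, schurZetaTerm, schurZetaTerm, one_div_mul_one_div]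
  rfl
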